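/- Let $\lambda\ge 1$. For a function $u(x,t)$, $x,t\in\mathbb R$, that is $\lambda$-periodic in $x$, write $\hat u(k)=\hat u(k,t)=\int_0^\lambda e^{-2\pi i kx}u(x,t)\,dx$ for $k\in\mathbb Z/\lambda=\{n/\lambda:n\in\mathbb Z\}$, and let $\tilde u(k,\tau)$ be the Fourier transform of $t\mapsto\hat u(k,t)$ in time (kernel $e^{-2\pi i\tau t}$, in the sense of tempered distributions). Let $\langle y\rangle=1+|y|$ and, for $s,b\in\mathbb R$, $$\|u\|_{X^{s,b}}=\Big(\frac1\lambda\sum_{k\in\mathbb Z/\lambda}\int_{\mathbb R}\langle k\rangle^{2s}\langle\tau-4\pi^2k^3\rangle^{2b}|\tilde u(k,\tau)|^2\,d\tau\Big)^{1/2}.$$ The same formula defines the norm of a $\lambda$-periodic distribution in $x$ that is given by its Fourier coefficients $\hat u(k,t)$; the norm is $\infty$ if the time Fourier transform of some $\hat u(k,\cdot)$ is not a function. For $\lambda$-periodic $u,v,w$ define $J[u,v,w]$ by its Fourier coefficients in $x$, $$\hat J[u,v,w](k)=\frac{ik}{3}\,\frac1{\lambda^2}\sum_{\substack{k_1+k_2+k_3=k\\(k_1+k_2)(k_2+k_3)(k_3+k_1)\ne0}}\hat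 u(k_1)\hat v(k_2)\hat w(k_3)\;-\;ik\,\frac1{\lambda^2}\,\hat u(k)\hat v(k)\hat w(-k),\qquad k_1,k_2,k_3,k\in\mathbb Z/\lambda.$$ **Proposition.** Let $s\ge\frac12$. For every $\varepsilon>0$ there is a constant $C=C(s,\varepsilon)>0$ such that for all $\lambda\ge1$ and all locally integrable functions $u,v,w$ that are $\lambda$-periodic in $x$ and have finite $X^{s,1/2}$ norm, the sums defining $\hat J[u,v,w](k)$ converge absolutely for almost every $t$ and all $k\in\mathbb Z/\lambda$, and $$\|J[u,v,w]\|_{X^{s,-\frac12}}\le C\,\lambda^{\varepsilon}\,\|u\|_{X^{s,\frac12}}\|v\|_{X^{s,\frac12}}\|w\|_{X^{s,\frac12}}.$$ -/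

import Mathlib

open MeasureTheory
open scoped ENNReal SchwartzMap FourierTransform

noncomputable section

namespace MKdV

/-- The bracket `⟨y⟩ = 1 + |y|`. -/
def bracket (y : ℝ) : ℝ := 1 + |y|

/-- `xCoeff L u n t` is the Fourier transform in `x`, at the frequency `k = n / L ∈ ℤ / L`, of a
function `u(x,t)` that is `L`-periodic in `x`:  `û(k)(t) = ∫₀ᴸ e^{-2πikx} u(x,t) dx`. -/
def xCoeff (L : ℝ) (u : ℝ → ℝ → ℂ) (n : ℤ) (t : ℝ) : ℂ :=
  ∫ x in (0 : ℝ)..L, Complex.exp (-(2 * Real.pi * ((n : ℝ) / L) * x : ℝ) * Complex.I) * u x t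

/-- `g` is the Fourier transform in time (kernel `e^{-2πiτt}`) of the function `f`, in the sense of
tempered distributions: both are tempered and `∫ f (𝓕 φ) = ∫ g φ` for all Schwartz functions `φ`.
Such a `g` is unique up to null sets. -/
def IsTimeFourier (f g : ℝ → ℂ) : Prop :=
  ∀ φ : 𝓢(ℝ, ℂ),
    Integrable (fun t => f t * (𝓕 φ : 𝓢(ℝ, ℂ)) t) ∧
    Integrable (fun τ => g τ * φ τ) ∧
    ∫ t, f t * (𝓕 φ : 𝓢(ℝ, ℂ)) t = ∫ τ, g τ * φ τ

/-- The norm `‖⟨k⟩^s ⟨τ - 4π²k³⟩^b g(k,τ)‖` in `L²((dk)_L dτ)`, where `(dk)_L` is `1 / L` times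
counting measure on `ℤ / L`, and `g n` stands for `g(k, ·)` at `k = n / L`. -/
def weightedNorm (L s b : ℝ) (g : ℤ → ℝ → ℂ) : ℝ≥0∞ :=
  (ENNReal.ofReal (1 / L) * ∑' n : ℤ, ∫⁻ τ : ℝ,
    (ENNReal.ofReal (bracket ((n : ℝ) / L) ^ s *
        bracket (τ - 4 * Real.pi ^ 2 * ((n : ℝ) / L) ^ 3) ^ b) * ‖g n τ‖ₑ) ^ 2) ^ (1 / 2 : ℝ)

/-- The `X^{s,b}` norm of the `L`-periodic object whose Fourier coefficients in `x` are the
functions `c n` of `t`: the weighted norm of its space-time Fourier transform `g`. As `g` is unique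
up to null sets, the infimum is over at most one value; it is `∞` if there is no such `g`. -/
def bourgainNorm (L s b : ℝ) (c : ℤ → ℝ → ℂ) : ℝ≥0∞ :=
  ⨅ (g : ℤ → ℝ → ℂ) (_ : ∀ n, IsTimeFourier (c n) (g n)), weightedNorm L s b g

/-- The function `u(x,t)` is `L`-periodic in `x` and belongs to `X^{s,b}`. -/
structure MemBourgain (L s b : ℝ) (u : ℝ → ℝ → ℂ) : Prop where
  periodic : ∀ x t, u (x + L) t = u x t
  locallyIntegrable : LocallyIntegrable (fun p : ℝ × ℝ => u p.1 p.2)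
  norm_lt_top : bourgainNorm L s b (xCoeff L u) < ∞

/-- Triples of (integer labels of) frequencies with `k₁ + k₂ + k₃ = k` and
`(k₁ + k₂)(k₂ + k₃)(k₃ + k₁) ≠ 0`. -/
def nonresonant (n : ℤ) : Set (ℤ × ℤ × ℤ) :=
  {p | p.1 + p.2.1 + p.2.2 = n ∧ (p.1 + p.2.1) * (p.2.1 + p.2.2) * (p.2.2 + p.1) ≠ 0}

/-- The summand `û(k₁) v̂(k₂) ŵ(k₃)` at time `t`. -/
def tripleTerm (L : ℝ) (u v w : ℝ → ℝ → ℂ) (t : ℝ) (p : ℤ × ℤ × ℤ) : ℂ :=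
  xCoeff L u p.1 t * xCoeff L v p.2.1 t * xCoeff L w p.2.2 t

/-- The Fourier coefficients in `x` (at `k = n / L`, as functions of `t`) of the renormalized
nonlinearity `J[u,v,w]`. Products of functions correspond to convolutions with respect to the
normalized counting measure `(dk)_L`, hence the factor `1 / L²` in front of both the sum over
`k₁ + k₂ + k₃ = k` and its diagonal term. -/
def J (L : ℝ) (u v w : ℝ → ℝ → ℂ) (n : ℤ) (t : ℝ) : ℂ :=
  Complex.I * (((n : ℝ) / L : ℝ) : ℂ) / 3 *
      ((1 / (L : ℂ) ^ 2) * ∑' p : nonresonant n, tripleTerm L u v w t p) -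
    Complex.I * (((n : ℝ) / L : ℝ) : ℂ) *
      ((1 / (L : ℂ) ^ 2) * (xCoeff L u n t * xCoeff L v n t * xCoeff L w (-n) t))

end MKdV

end

noncomputable section

namespace MKdV

/-! ### Cauchy–Schwarz and weights -/

/-! The estimate is proved on the Fourier side by Cauchy–Schwarz alone, first in time at fixed
frequencies and then over frequency triples.

In time (`lintegral_modulation_le`): the distance between the surface of the output and the sum of
the three input surfaces is at most the sum of the four modulations. The square root of this
distance can therefore be charged to one of the four weights. The three that remain occur with first
inverse powers after Cauchy–Schwarz, and their product is integrable over the plane of time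
frequencies, because the largest of them can give half a power to each of the other two. So the
whole distance is gained, with no loss at the endpoint `b = 1/2`.

In space: that distance is `12π²|(k₁+k₂)(k₂+k₃)(k₃+k₁)|`. By `multiplier_rpow_le` the derivative in
`J` and the output weight are controlled by this resonance function, the three input weights and
`freqWeight (1 + δ)`. Each summand of `freqWeight` is a product of two inverse powers, of order
above one, of linear forms that are independent modulo the constraint `k₁+k₂+k₃=k`. Hence
`tsum_freqWeight_le` bounds its sum over the triples by a multiple of `L^(2+2δ)`, uniformly in `k`.
Cauchy–Schwarz with this weight leaves a sum of products of energies, which factorizes. The term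
`(k,k,-k)` has zero resonance, and `|k| ≤ ⟨k⟩^(2s)` suffices there.

Powers of the period in the squared norms: `L⁻⁴` from `J`, `L^(2+2δ)` from the lattice sum, `L⁻¹`
from the norm on the left and `L³` from undoing the three normalizations on the right. The total is
`L^(2δ)`, and the square root is the claimed loss.

The passage to the Fourier side is `exists_isTimeFourier_triple` for a single product and
`isTimeFourier_tsum` for the infinite sum; the square integrability behind the latter also gives
absolute convergence for almost every time. -/

theorem lintegral_sq_le_mul {α : Type*} [MeasurableSpace α] {μ : Measure α} {u p q : α → ℝ≥0∞}
    (hp : AEMeasurable p μ) (hq : AEMeasurable q μ) (h : ∀ x, u x ^ 2 ≤ p x * q x) :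
    (∫⁻ x, u x ∂μ) ^ 2 ≤ (∫⁻ x, p x ∂μ) * ∫⁻ x, q x ∂μ := by
  have hu : ∀ x, u x ≤ p x ^ (1 / 2 : ℝ) * q x ^ (1 / 2 : ℝ) := fun x => by
    have := ENNReal.rpow_le_rpow (h x) (by norm_num : (0 : ℝ) ≤ 1 / 2)
    rwa [ENNReal.mul_rpow_of_nonneg _ _ (by norm_num), ← ENNReal.rpow_natCast,
      ← ENNReal.rpow_mul, show ((2 : ℕ) : ℝ) * (1 / 2) = 1 by norm_num, ENNReal.rpow_one] at this
  have hpow : ∀ z : ℝ≥0∞, (z ^ (1 / 2 : ℝ)) ^ (2 : ℝ) = z := fun z => by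
    rw [← ENNReal.rpow_mul]; norm_num
  have key := (lintegral_mono hu).trans
    (ENNReal.lintegral_mul_le_Lp_mul_Lq μ Real.HolderConjugate.two_two
      (hp.pow_const (1 / 2 : ℝ)) (hq.pow_const (1 / 2 : ℝ)))
  simp only [hpow] at key
  calc (∫⁻ x, u x ∂μ) ^ 2
      ≤ ((∫⁻ x, p x ∂μ) ^ (1 / 2 : ℝ) * (∫⁻ x, q x ∂μ) ^ (1 / 2 : ℝ)) ^ 2 := by gcongr
    _ = _ := by
      rw [mul_pow, ← ENNReal.rpow_natCast, ← ENNReal.rpow_natCast, Nat.cast_ofNat, hpow, hpow]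

theorem tsum_sq_le_mul {ι : Type*} {u p q : ι → ℝ≥0∞} (h : ∀ i, u i ^ 2 ≤ p i * q i) :
    (∑' i, u i) ^ 2 ≤ (∑' i, p i) * ∑' i, q i := by
  let _ : MeasurableSpace ι := ⊤
  have := lintegral_sq_le_mul (μ := Measure.count) (measurable_from_top (f := p)).aemeasurable
    (measurable_from_top (f := q)).aemeasurable h
  simpa [lintegral_count' measurable_from_top] using this

theorem ENNReal_add_sq_le (x y : ℝ≥0∞) : (x + y) ^ 2 ≤ 2 * (x ^ 2 + y ^ 2) := by
  have := ENNReal.rpow_add_le_mul_rpow_add_rpow x y (p := 2) (by norm_num)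
  norm_num at this
  exact this

/-- If `1 ≤ x, y ≤ z` then a factor `z⁻¹` may be traded for half a power of `x` and `y`. -/
theorem inv_mul_inv_mul_inv_le_of_le {x y z : ℝ≥0∞} (hx : 1 ≤ x) (hx' : x ≠ ∞) (hy : 1 ≤ y)
    (hy' : y ≠ ∞) (hxz : x ≤ z) (hyz : y ≤ z) :
    x⁻¹ * y⁻¹ * z⁻¹ ≤ x ^ (-(3 / 2) : ℝ) * y ^ (-(3 / 2) : ℝ) := by
  have h0 : ∀ a : ℝ≥0∞, 1 ≤ a → a ≠ ∞ → a ^ (-(3 / 2) : ℝ) = a⁻¹ * (a ^ (1 / 2 : ℝ))⁻¹ := by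
    intro a ha ha'
    rw [← ENNReal.rpow_neg, ← ENNReal.rpow_neg_one,
      ← ENNReal.rpow_add _ _ (zero_lt_one.trans_le ha).ne' ha']
    norm_num
  have hz : x ^ (1 / 2 : ℝ) * y ^ (1 / 2 : ℝ) ≤ z := by
    calc x ^ (1 / 2 : ℝ) * y ^ (1 / 2 : ℝ) ≤ z ^ (1 / 2 : ℝ) * z ^ (1 / 2 : ℝ) := by gcongr
      _ = z := by
        rw [← ENNReal.rpow_add_of_nonneg _ _ (by norm_num) (by norm_num)]; norm_num
  have hz' := ENNReal.inv_le_inv.2 hz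
  rw [ENNReal.mul_inv (Or.inr (by simp [hy'])) (Or.inl (by simp [hx']))] at hz'
  rw [h0 x hx hx', h0 y hy hy']
  calc x⁻¹ * y⁻¹ * z⁻¹ ≤ x⁻¹ * y⁻¹ * ((x ^ (1 / 2 : ℝ))⁻¹ * (y ^ (1 / 2 : ℝ))⁻¹) := by gcongr
    _ = _ := by ring

/-- Whichever of the three is largest gives up its power to the other two, and the sum on the right
covers the three cases. Each summand is integrable in two independent variables, although one first
inverse power is not integrable in one. -/
theorem inv_mul_inv_mul_inv_le {x y z : ℝ≥0∞} (hx : 1 ≤ x) (hx' : x ≠ ∞) (hy : 1 ≤ y)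
    (hy' : y ≠ ∞) (hz : 1 ≤ z) (hz' : z ≠ ∞) :
    x⁻¹ * y⁻¹ * z⁻¹ ≤ x ^ (-(3 / 2) : ℝ) * y ^ (-(3 / 2) : ℝ) +
      y ^ (-(3 / 2) : ℝ) * z ^ (-(3 / 2) : ℝ) + x ^ (-(3 / 2) : ℝ) * z ^ (-(3 / 2) : ℝ) := by
  have c1 : y ≤ x → z ≤ x → x⁻¹ * y⁻¹ * z⁻¹ ≤ y ^ (-(3 / 2) : ℝ) * z ^ (-(3 / 2) : ℝ) :=
    fun h1 h2 => by
      rw [show x⁻¹ * y⁻¹ * z⁻¹ = y⁻¹ * z⁻¹ * x⁻¹ by ring]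
      exact inv_mul_inv_mul_inv_le_of_le hy hy' hz hz' h1 h2
  have c2 : x ≤ y → z ≤ y → x⁻¹ * y⁻¹ * z⁻¹ ≤ x ^ (-(3 / 2) : ℝ) * z ^ (-(3 / 2) : ℝ) :=
    fun h1 h2 => by
      rw [show x⁻¹ * y⁻¹ * z⁻¹ = x⁻¹ * z⁻¹ * y⁻¹ by ring]
      exact inv_mul_inv_mul_inv_le_of_le hx hx' hz hz' h1 h2
  have c3 : x ≤ z → y ≤ z → x⁻¹ * y⁻¹ * z⁻¹ ≤ x ^ (-(3 / 2) : ℝ) * y ^ (-(3 / 2) : ℝ) :=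
    fun h1 h2 => inv_mul_inv_mul_inv_le_of_le hx hx' hy hy' h1 h2
  rcases le_total x y with h1 | h1
  · rcases le_total y z with h2 | h2
    · exact (c3 (h1.trans h2) h2).trans (by rw [add_assoc]; exact le_self_add)
    · exact (c2 h1 h2).trans le_add_self
  · rcases le_total x z with h2 | h2
    · exact (c3 h2 (h1.trans h2)).trans (by rw [add_assoc]; exact le_self_add)
    · exact (c1 h1 h2).trans (le_add_self.trans le_self_add)

/-- The weight `⟨y - α⟩` with values in `[0, ∞]`. -/
def wt (α y : ℝ) : ℝ≥0∞ := ENNReal.ofReal (bracket (y - α))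

theorem one_le_bracket (y : ℝ) : 1 ≤ bracket y := by
  unfold bracket; linarith [abs_nonneg y]

theorem bracket_pos (y : ℝ) : 0 < bracket y := zero_lt_one.trans_le (one_le_bracket y)

theorem bracket_neg (y : ℝ) : bracket (-y) = bracket y := by simp [bracket]

@[fun_prop]
theorem continuous_bracket : Continuous bracket := by unfold bracket; fun_prop

@[fun_prop]
theorem measurable_wt (α : ℝ) : Measurable (wt α) := by
  unfold wt
  exact ENNReal.measurable_ofReal.comp (by fun_prop : Continuous fun y => bracket (y - α)).measurable

theorem one_le_wt (α y : ℝ) : 1 ≤ wt α y := by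
  rw [wt, ENNReal.one_le_ofReal]; exact one_le_bracket _

theorem wt_ne_top (α y : ℝ) : wt α y ≠ ∞ := ENNReal.ofReal_ne_top

theorem wt_ne_zero (α y : ℝ) : wt α y ≠ 0 := (zero_lt_one.trans_le (one_le_wt α y)).ne'

/-- `∫ ⟨y⟩^{-3/2} dy`. -/
def kap : ℝ≥0∞ := ∫⁻ y, wt 0 y ^ (-(3 / 2) : ℝ)

theorem kap_lt_top : kap < ∞ := by
  have h := finite_integral_one_add_norm (E := ℝ) (μ := volume) (r := 3 / 2) (by norm_num)
  refine (lintegral_congr fun y => ?_).trans_lt h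
  rw [wt, ENNReal.ofReal_rpow_of_pos (bracket_pos _)]
  simp [bracket]

theorem lintegral_wt_rpow (α : ℝ) : ∫⁻ y, wt α y ^ (-(3 / 2) : ℝ) = kap := by
  have := lintegral_sub_right_eq_self (μ := volume) (fun y => wt 0 y ^ (-(3 / 2) : ℝ)) α
  rw [kap, ← this]; simp [wt]

theorem lintegral_wt_sub_rpow (α x : ℝ) : ∫⁻ y, wt α (x - y) ^ (-(3 / 2) : ℝ) = kap := by
  rw [lintegral_sub_left_eq_self (μ := volume) (fun y => wt α y ^ (-(3 / 2) : ℝ)) x,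
    lintegral_wt_rpow]

/-- The integral over `τ₁ + τ₂ + τ₃ = x` of three inverse weights is bounded. -/
theorem lintegral_triple_wt_le (α β γ x : ℝ) :
    ∫⁻ z : ℝ × ℝ, (wt α (x - z.1 - z.2))⁻¹ * (wt β z.2)⁻¹ * (wt γ z.1)⁻¹ ≤ 3 * kap ^ 2 := by
  have hm : ∀ α, Measurable fun y => wt α y ^ (-(3 / 2) : ℝ) := fun α =>
    (measurable_wt α).pow_const _
  have m1 : Measurable fun z : ℝ × ℝ => wt α (x - z.1 - z.2) ^ (-(3 / 2) : ℝ) :=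
    (hm α).comp (by fun_prop)
  have m2 : Measurable fun z : ℝ × ℝ => wt β z.2 ^ (-(3 / 2) : ℝ) := (hm β).comp (by fun_prop)
  have m3 : Measurable fun z : ℝ × ℝ => wt γ z.1 ^ (-(3 / 2) : ℝ) := (hm γ).comp (by fun_prop)
  refine (lintegral_mono fun z => inv_mul_inv_mul_inv_le (one_le_wt _ _) (wt_ne_top _ _)
    (one_le_wt _ _) (wt_ne_top _ _) (one_le_wt _ _) (wt_ne_top _ _)).trans ?_
  rw [lintegral_add_right _ (by fun_prop), lintegral_add_right _ (by fun_prop)]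
  have i1 : ∫⁻ z : ℝ × ℝ, wt α (x - z.1 - z.2) ^ (-(3 / 2) : ℝ) * wt β z.2 ^ (-(3 / 2) : ℝ)
      = kap ^ 2 := by
    rw [Measure.volume_eq_prod, lintegral_prod_symm _ (by fun_prop)]
    simp only
    have : ∀ y : ℝ, ∫⁻ t : ℝ, wt α (x - t - y) ^ (-(3 / 2) : ℝ) * wt β y ^ (-(3 / 2) : ℝ)
        = kap * wt β y ^ (-(3 / 2) : ℝ) := fun y => by
      rw [lintegral_mul_const _ (by fun_prop)]
      simp only [sub_right_comm x _ y, lintegral_wt_sub_rpow]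
    simp only [this]
    rw [lintegral_const_mul _ (hm β), lintegral_wt_rpow, sq]
  have i2 : ∫⁻ z : ℝ × ℝ, wt β z.2 ^ (-(3 / 2) : ℝ) * wt γ z.1 ^ (-(3 / 2) : ℝ) = kap ^ 2 := by
    simp only [mul_comm (wt β _ ^ (_ : ℝ))]
    rw [Measure.volume_eq_prod, lintegral_prod_mul (hm γ).aemeasurable (hm β).aemeasurable,
      lintegral_wt_rpow, lintegral_wt_rpow, sq]
  have i3 : ∫⁻ z : ℝ × ℝ, wt α (x - z.1 - z.2) ^ (-(3 / 2) : ℝ) * wt γ z.1 ^ (-(3 / 2) : ℝ)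
      = kap ^ 2 := by
    rw [Measure.volume_eq_prod, lintegral_prod _ (by fun_prop)]
    simp only
    have : ∀ y : ℝ, ∫⁻ t : ℝ, wt α (x - y - t) ^ (-(3 / 2) : ℝ) * wt γ y ^ (-(3 / 2) : ℝ)
        = kap * wt γ y ^ (-(3 / 2) : ℝ) := fun y => by
      rw [lintegral_mul_const _ (by fun_prop), lintegral_wt_sub_rpow]
    simp only [this]
    rw [lintegral_const_mul _ (hm γ), lintegral_wt_rpow, sq]
  rw [i1, i2, i3]
  exact le_of_eq (by ring)

/-- The integral over `τ₁ + τ₂ = x` of two inverse weights is bounded. -/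
theorem lintegral_double_wt_le (α β x : ℝ) :
    ∫⁻ y, (wt α (x - y))⁻¹ * (wt β y)⁻¹ ≤ 2 * kap := by
  have key : ∀ a b : ℝ≥0∞, 1 ≤ a → 1 ≤ b → a⁻¹ * b⁻¹ ≤ a ^ (-(3 / 2) : ℝ) + b ^ (-(3 / 2) : ℝ) := by
    have aux : ∀ a b : ℝ≥0∞, 1 ≤ a → a ≤ b → a⁻¹ * b⁻¹ ≤ a ^ (-(3 / 2) : ℝ) := by
      intro a b ha hab
      have hb := ENNReal.inv_le_inv.2 hab
      calc a⁻¹ * b⁻¹ ≤ a⁻¹ * a⁻¹ := by gcongr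
        _ = (a ^ (2 : ℝ))⁻¹ := by rw [← ENNReal.inv_rpow]; norm_num [sq]
        _ ≤ (a ^ (3 / 2 : ℝ))⁻¹ :=
          ENNReal.inv_le_inv.2 (ENNReal.rpow_le_rpow_of_exponent_le ha (by norm_num))
        _ = _ := (ENNReal.rpow_neg _ _).symm
    intro a b ha hb
    rcases le_total a b with h | h
    · exact (aux a b ha h).trans le_self_add
    · rw [mul_comm]; exact (aux b a hb h).trans le_add_self
  refine (lintegral_mono fun y => key _ _ (one_le_wt _ _) (one_le_wt _ _)).trans ?_
  rw [lintegral_add_right _ ((measurable_wt β).pow_const _), lintegral_wt_sub_rpow,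
    lintegral_wt_rpow, two_mul]

/-! ### Convolutions of nonnegative functions with weights -/

/-- The convolution of three nonnegative functions. -/
def conv3 (A B C : ℝ → ℝ≥0∞) (x : ℝ) : ℝ≥0∞ :=
  ∫⁻ z : ℝ × ℝ, A (x - z.1 - z.2) * B z.2 * C z.1

section

variable {A B C : ℝ → ℝ≥0∞}

theorem measurable_conv3 (hA : Measurable A) (hB : Measurable B) (hC : Measurable C) :
    Measurable (conv3 A B C) := by
  unfold conv3
  refine Measurable.lintegral_prod_right'
    (f := fun p : ℝ × (ℝ × ℝ) => A (p.1 - p.2.1 - p.2.2) * B p.2.2 * C p.2.1) ?_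
  fun_prop

theorem conv3_swap_right (A B C : ℝ → ℝ≥0∞) :
    conv3 A B C = conv3 A C B := by
  ext x
  unfold conv3
  rw [Measure.volume_eq_prod, ← lintegral_prod_swap]
  refine lintegral_congr fun z => ?_
  simp only [Prod.fst_swap, Prod.snd_swap]
  rw [sub_right_comm, mul_right_comm]

theorem conv3_swap_left (hA : Measurable A) (hB : Measurable B) (hC : Measurable C) :
    conv3 A B C = conv3 B A C := by
  ext x
  unfold conv3
  rw [Measure.volume_eq_prod, lintegral_prod _ (by fun_prop), lintegral_prod _ (by fun_prop)]
  refine lintegral_congr fun y => ?_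
  simp only
  rw [← lintegral_sub_left_eq_self (μ := volume) _ (x - y)]
  refine lintegral_congr fun t => ?_
  rw [sub_sub_cancel, mul_comm (A t)]

theorem lintegral_conv3 (hA : Measurable A) (hB : Measurable B) (hC : Measurable C) :
    ∫⁻ x, conv3 A B C x = (∫⁻ x, A x) * (∫⁻ x, B x) * ∫⁻ x, C x := by
  unfold conv3
  rw [lintegral_lintegral_swap (by fun_prop)]
  have : ∀ z : ℝ × ℝ, ∫⁻ x, A (x - z.1 - z.2) * B z.2 * C z.1
      = (∫⁻ x, A x) * (C z.1 * B z.2) := fun z => by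
    simp only [mul_assoc]
    rw [lintegral_mul_const _ (by fun_prop)]
    simp only [sub_sub]
    rw [lintegral_sub_right_eq_self (μ := volume) A, mul_comm (B _)]
  simp only [this]
  rw [lintegral_const_mul _ (by fun_prop), Measure.volume_eq_prod,
    lintegral_prod_mul hC.aemeasurable hB.aemeasurable, mul_assoc, mul_comm (∫⁻ x, B x)]

/-- Cauchy–Schwarz after inserting each weight and its inverse; the integral of the inverse weights
is bounded uniformly in `x`. -/
theorem conv3_sq_le (hA : Measurable A) (hB : Measurable B) (hC : Measurable C) (α β γ x : ℝ) :
    conv3 A B C x ^ 2 ≤ 3 * kap ^ 2 * conv3 (fun y => wt α y * A y ^ 2)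
      (fun y => wt β y * B y ^ 2) (fun y => wt γ y * C y ^ 2) x := by
  refine (lintegral_sq_le_mul
    (p := fun z : ℝ × ℝ => (wt α (x - z.1 - z.2))⁻¹ * (wt β z.2)⁻¹ * (wt γ z.1)⁻¹)
    (q := fun z : ℝ × ℝ => wt α (x - z.1 - z.2) * A (x - z.1 - z.2) ^ 2 *
      (wt β z.2 * B z.2 ^ 2) * (wt γ z.1 * C z.1 ^ 2))
    (by fun_prop) (by fun_prop) fun z => le_of_eq ?_).trans ?_
  · have h1 := ENNReal.inv_mul_cancel (wt_ne_zero α (x - z.1 - z.2)) (wt_ne_top _ _)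
    have h2 := ENNReal.inv_mul_cancel (wt_ne_zero β z.2) (wt_ne_top _ _)
    have h3 := ENNReal.inv_mul_cancel (wt_ne_zero γ z.1) (wt_ne_top _ _)
    calc _ = ((wt α (x - z.1 - z.2))⁻¹ * wt α (x - z.1 - z.2)) * ((wt β z.2)⁻¹ * wt β z.2) *
          ((wt γ z.1)⁻¹ * wt γ z.1) * (A (x - z.1 - z.2) * B z.2 * C z.1) ^ 2 := by
          rw [h1, h2, h3]; ring
      _ = _ := by ring
  · exact mul_le_mul_left (lintegral_triple_wt_le α β γ x) _

theorem lintegral_conv3_sq_le (hA : Measurable A) (hB : Measurable B) (hC : Measurable C)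
    (α β γ : ℝ) :
    ∫⁻ x, conv3 A B C x ^ 2 ≤ 3 * kap ^ 2 * ((∫⁻ y, wt α y * A y ^ 2) *
      (∫⁻ y, wt β y * B y ^ 2) * ∫⁻ y, wt γ y * C y ^ 2) := by
  refine (lintegral_mono fun x => conv3_sq_le hA hB hC α β γ x).trans ?_
  rw [lintegral_const_mul _ (measurable_conv3 (by fun_prop) (by fun_prop) (by fun_prop)),
    lintegral_conv3 (by fun_prop) (by fun_prop) (by fun_prop)]

/-- The factor `A` carries no weight, because its weight will have been spent on the resonance. The
inverse weight of the output replaces it: once the variable of `A` is frozen, the remaining integral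
again contains three inverse weights over a plane. -/
theorem lintegral_inv_wt_mul_conv3_sq_le (hA : Measurable A) (hB : Measurable B)
    (hC : Measurable C) (α β γ : ℝ) :
    ∫⁻ x, (wt α x)⁻¹ * conv3 A B C x ^ 2 ≤ 3 * kap ^ 2 * ((∫⁻ y, A y ^ 2) *
      (∫⁻ y, wt β y * B y ^ 2) * ∫⁻ y, wt γ y * C y ^ 2) := by
  set P := (∫⁻ y, wt γ y * C y ^ 2) * ∫⁻ y, wt β y * B y ^ 2
  have hpt : ∀ x, conv3 A B C x ^ 2 ≤
      P * ∫⁻ z : ℝ × ℝ, A (x - z.1 - z.2) ^ 2 * (wt β z.2)⁻¹ * (wt γ z.1)⁻¹ := fun x => by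
    refine (lintegral_sq_le_mul
      (p := fun z : ℝ × ℝ => (wt γ z.1 * C z.1 ^ 2) * (wt β z.2 * B z.2 ^ 2))
      (q := fun z : ℝ × ℝ => A (x - z.1 - z.2) ^ 2 * (wt β z.2)⁻¹ * (wt γ z.1)⁻¹)
      (by fun_prop) (by fun_prop) fun z => le_of_eq ?_).trans ?_
    · have h2 := ENNReal.inv_mul_cancel (wt_ne_zero β z.2) (wt_ne_top _ _)
      have h3 := ENNReal.inv_mul_cancel (wt_ne_zero γ z.1) (wt_ne_top _ _)
      calc _ = ((wt β z.2)⁻¹ * wt β z.2) * ((wt γ z.1)⁻¹ * wt γ z.1) *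
            (A (x - z.1 - z.2) * B z.2 * C z.1) ^ 2 := by rw [h2, h3]; ring
        _ = _ := by ring
    · rw [Measure.volume_eq_prod, lintegral_prod_mul
        (f := fun y => wt γ y * C y ^ 2) (g := fun y => wt β y * B y ^ 2)
        (by fun_prop) (by fun_prop)]
  calc ∫⁻ x, (wt α x)⁻¹ * conv3 A B C x ^ 2
      ≤ ∫⁻ x, P * ∫⁻ z : ℝ × ℝ,
          (wt α x)⁻¹ * (A (x - z.1 - z.2) ^ 2 * (wt β z.2)⁻¹ * (wt γ z.1)⁻¹) := by
        refine lintegral_mono fun x => ?_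
        rw [lintegral_const_mul _ (by fun_prop)]
        calc (wt α x)⁻¹ * conv3 A B C x ^ 2 ≤ (wt α x)⁻¹ * _ := mul_le_mul_right (hpt x) _
          _ = _ := by ring
    _ = P * ∫⁻ z : ℝ × ℝ, ∫⁻ x,
          (wt α x)⁻¹ * (A (x - z.1 - z.2) ^ 2 * (wt β z.2)⁻¹ * (wt γ z.1)⁻¹) := by
        rw [lintegral_const_mul, lintegral_lintegral_swap (by fun_prop)]
        exact Measurable.lintegral_prod_right' (f := fun p : ℝ × (ℝ × ℝ) =>
          (wt α p.1)⁻¹ * (A (p.1 - p.2.1 - p.2.2) ^ 2 * (wt β p.2.2)⁻¹ * (wt γ p.2.1)⁻¹))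
          (by fun_prop)
    -- Translate so that `y` is the argument of `A`, and use that the bracket is even to bring the
    -- output weight into the form required by `lintegral_triple_wt_le`.
    _ = P * ∫⁻ z : ℝ × ℝ, ∫⁻ y,
          A y ^ 2 * ((wt (-α) (-y - z.1 - z.2))⁻¹ * (wt β z.2)⁻¹ * (wt γ z.1)⁻¹) := by
        congr 1
        refine lintegral_congr fun z => ?_
        rw [← lintegral_add_right_eq_self (μ := volume) _ (z.1 + z.2)]
        refine lintegral_congr fun y => ?_
        have e1 : y + (z.1 + z.2) - z.1 - z.2 = y := by ring
        have e2 : wt (-α) (-y - z.1 - z.2) = wt α (y + (z.1 + z.2)) := by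
          unfold wt; rw [← bracket_neg]; congr 2; ring
        rw [e1, e2]; ring
    _ = P * ∫⁻ y, A y ^ 2 * ∫⁻ z : ℝ × ℝ,
          (wt (-α) (-y - z.1 - z.2))⁻¹ * (wt β z.2)⁻¹ * (wt γ z.1)⁻¹ := by
        rw [lintegral_lintegral_swap (by fun_prop)]
        congr 1
        exact lintegral_congr fun y => lintegral_const_mul _ (by fun_prop)
    _ ≤ P * ∫⁻ y, A y ^ 2 * (3 * kap ^ 2) := by
        gcongr with y
        exact lintegral_triple_wt_le _ _ _ _
    _ = _ := by rw [lintegral_mul_const _ (by fun_prop)]; ring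

/-- The trilinear estimate in time at fixed frequencies: the distance `α - α₁ - α₂ - α₃` between
the characteristic surfaces is gained in full. -/
theorem lintegral_modulation_le (hA : Measurable A) (hB : Measurable B) (hC : Measurable C)
    (α α₁ α₂ α₃ : ℝ) :
    ENNReal.ofReal (bracket (α - α₁ - α₂ - α₃)) * ∫⁻ x, (wt α x)⁻¹ * conv3 A B C x ^ 2 ≤
      48 * kap ^ 2 * ((∫⁻ y, wt α₁ y * A y ^ 2) *
        (∫⁻ y, wt α₂ y * B y ^ 2) * ∫⁻ y, wt α₃ y * C y ^ 2) := by
  set d := ENNReal.ofReal (bracket (α - α₁ - α₂ - α₃))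
  set h : ℝ → ℝ → ℝ≥0∞ := fun β y => wt β y ^ (1 / 2 : ℝ)
  have hm : ∀ β, Measurable (h β) := fun β => (measurable_wt β).pow_const _
  have hmul : ∀ β {G : ℝ → ℝ≥0∞}, Measurable G → Measurable fun y => h β y * G y :=
    fun β _ hG => (hm β).mul hG
  have hsq : ∀ z : ℝ≥0∞, (z ^ (1 / 2 : ℝ)) ^ 2 = z := fun z => by
    rw [← ENNReal.rpow_natCast, ← ENNReal.rpow_mul]; norm_num
  set Q₁ := conv3 (fun y => h α₁ y * A y) B C
  set Q₂ := conv3 A (fun y => h α₂ y * B y) C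
  set Q₃ := conv3 A B (fun y => h α₃ y * C y)
  have mQ : Measurable (conv3 A B C) := measurable_conv3 hA hB hC
  have mQ₁ : Measurable Q₁ := measurable_conv3 (hmul _ hA) hB hC
  have mQ₂ : Measurable Q₂ := measurable_conv3 hA (hmul _ hB) hC
  have mQ₃ : Measurable Q₃ := measurable_conv3 hA hB (hmul _ hC)
  -- The time frequencies of the inputs add up to `x`, so the signed modulations add up to the
  -- resonance; the square root is subadditive.
  have hd : ∀ (x : ℝ) (z : ℝ × ℝ), d ^ (1 / 2 : ℝ) ≤
      h α x + h α₁ (x - z.1 - z.2) + h α₂ z.2 + h α₃ z.1 := by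
    intro x z
    have h0 : d ≤ wt α x + wt α₁ (x - z.1 - z.2) + wt α₂ z.2 + wt α₃ z.1 := by
      simp only [d, wt]
      rw [← ENNReal.ofReal_add (bracket_pos _).le (bracket_pos _).le,
        ← ENNReal.ofReal_add (add_pos (bracket_pos _) (bracket_pos _)).le (bracket_pos _).le,
        ← ENNReal.ofReal_add (add_pos (add_pos (bracket_pos _) (bracket_pos _))
          (bracket_pos _)).le (bracket_pos _).le]
      refine ENNReal.ofReal_le_ofReal ?_
      unfold bracket
      have e : α - α₁ - α₂ - α₃ =
          -(x - α) + (x - z.1 - z.2 - α₁) + (z.2 - α₂) + (z.1 - α₃) := by ring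
      rw [e]
      have t1 := abs_add_le (-(x - α) + (x - z.1 - z.2 - α₁) + (z.2 - α₂)) (z.1 - α₃)
      have t2 := abs_add_le (-(x - α) + (x - z.1 - z.2 - α₁)) (z.2 - α₂)
      have t3 := abs_add_le (-(x - α)) (x - z.1 - z.2 - α₁)
      rw [abs_neg] at t3
      linarith
    have hr : ∀ a b : ℝ≥0∞, (a + b) ^ (1 / 2 : ℝ) ≤ a ^ (1 / 2 : ℝ) + b ^ (1 / 2 : ℝ) :=
      fun a b => ENNReal.rpow_add_le_add_rpow a b (by norm_num) (by norm_num)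
    refine (ENNReal.rpow_le_rpow h0 (by norm_num)).trans ?_
    refine (hr _ _).trans (add_le_add ((hr _ _).trans (add_le_add (hr _ _) le_rfl)) le_rfl)
  have hpt : ∀ x, d ^ (1 / 2 : ℝ) * conv3 A B C x ≤
      (h α x * conv3 A B C x + Q₁ x) + (Q₂ x + Q₃ x) := by
    intro x
    simp only [Q₁, Q₂, Q₃, conv3]
    rw [← lintegral_const_mul _ (by fun_prop), ← lintegral_const_mul _ (by fun_prop),
      ← lintegral_add_left (by fun_prop), ← lintegral_add_left (by fun_prop),
      ← lintegral_add_left (by fun_prop)]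
    refine lintegral_mono fun z => ?_
    refine (mul_le_mul_left (hd x z) _).trans (le_of_eq ?_)
    ring
  -- Squaring a sum of four terms, paired two by two, costs the factor `4`. In the first term the
  -- output weight cancels; in each of the others one input weight has been used up.
  have hpt2 : ∀ x, d * ((wt α x)⁻¹ * conv3 A B C x ^ 2) ≤
      4 * ((conv3 A B C x ^ 2 + (wt α x)⁻¹ * Q₁ x ^ 2) +
        ((wt α x)⁻¹ * Q₂ x ^ 2 + (wt α x)⁻¹ * Q₃ x ^ 2)) := by
    intro x
    have h1 := ENNReal.inv_mul_cancel (wt_ne_zero α x) (wt_ne_top _ _)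
    calc d * ((wt α x)⁻¹ * conv3 A B C x ^ 2)
        = (wt α x)⁻¹ * (d ^ (1 / 2 : ℝ) * conv3 A B C x) ^ 2 := by rw [mul_pow, hsq]; ring
      _ ≤ (wt α x)⁻¹ * (2 * (2 * ((h α x * conv3 A B C x) ^ 2 + Q₁ x ^ 2) +
            2 * (Q₂ x ^ 2 + Q₃ x ^ 2))) := by
          refine mul_le_mul_right (((pow_le_pow_left' (hpt x) 2).trans
            (ENNReal_add_sq_le _ _)).trans ?_) _
          gcongr <;> exact ENNReal_add_sq_le _ _
      _ = 4 * (((wt α x)⁻¹ * wt α x * conv3 A B C x ^ 2 + (wt α x)⁻¹ * Q₁ x ^ 2) +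
            ((wt α x)⁻¹ * Q₂ x ^ 2 + (wt α x)⁻¹ * Q₃ x ^ 2)) := by
          rw [mul_pow, hsq]; ring
      _ = _ := by rw [h1, one_mul]
  have hh : ∀ (β : ℝ) (G : ℝ → ℝ≥0∞), ∫⁻ y, (h β y * G y) ^ 2 = ∫⁻ y, wt β y * G y ^ 2 :=
    fun β G => by simp only [h, mul_pow, hsq]
  set Pr := (∫⁻ y, wt α₁ y * A y ^ 2) * (∫⁻ y, wt α₂ y * B y ^ 2) * ∫⁻ y, wt α₃ y * C y ^ 2
  have b0 : ∫⁻ x, conv3 A B C x ^ 2 ≤ 3 * kap ^ 2 * Pr := lintegral_conv3_sq_le hA hB hC _ _ _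
  have b1 : ∫⁻ x, (wt α x)⁻¹ * Q₁ x ^ 2 ≤ 3 * kap ^ 2 * Pr := by
    refine (lintegral_inv_wt_mul_conv3_sq_le (hmul _ hA) hB hC α α₂ α₃).trans (le_of_eq ?_)
    rw [hh]
  have b2 : ∫⁻ x, (wt α x)⁻¹ * Q₂ x ^ 2 ≤ 3 * kap ^ 2 * Pr := by
    simp only [Q₂]
    rw [conv3_swap_left hA (hmul _ hB) hC]
    refine (lintegral_inv_wt_mul_conv3_sq_le (hmul _ hB) hA hC α α₁ α₃).trans (le_of_eq ?_)
    rw [hh]; ring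
  have b3 : ∫⁻ x, (wt α x)⁻¹ * Q₃ x ^ 2 ≤ 3 * kap ^ 2 * Pr := by
    simp only [Q₃]
    rw [conv3_swap_right A B, conv3_swap_left hA (hmul _ hC) hB]
    refine (lintegral_inv_wt_mul_conv3_sq_le (hmul _ hC) hA hB α α₁ α₂).trans (le_of_eq ?_)
    rw [hh]; ring
  rw [← lintegral_const_mul _ (by fun_prop)]
  refine (lintegral_mono hpt2).trans ?_
  rw [lintegral_const_mul _ (by fun_prop), lintegral_add_left (by fun_prop),
    lintegral_add_left (by fun_prop), lintegral_add_left (by fun_prop)]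
  calc _ ≤ 4 * ((3 * kap ^ 2 * Pr + 3 * kap ^ 2 * Pr) + (3 * kap ^ 2 * Pr + 3 * kap ^ 2 * Pr)) := by
        gcongr
    _ = _ := by ring

/-- Needed only qualitatively: the transform of a product of two factors is again square integrable,
so the convolution theorem can be applied a second time. -/
theorem lintegral_conv2_sq_le (hA : Measurable A) (hB : Measurable B) (α β : ℝ) :
    ∫⁻ x, (∫⁻ y, A (x - y) * B y) ^ 2 ≤
      2 * kap * ((∫⁻ y, wt α y * A y ^ 2) * ∫⁻ y, wt β y * B y ^ 2) := by
  have hpt : ∀ x, (∫⁻ y, A (x - y) * B y) ^ 2 ≤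
      2 * kap * ∫⁻ y, (wt α (x - y) * A (x - y) ^ 2) * (wt β y * B y ^ 2) := fun x => by
    refine (lintegral_sq_le_mul
      (p := fun y => (wt α (x - y))⁻¹ * (wt β y)⁻¹)
      (q := fun y => (wt α (x - y) * A (x - y) ^ 2) * (wt β y * B y ^ 2))
      (by fun_prop) (by fun_prop) fun y => le_of_eq ?_).trans
      (mul_le_mul_left (lintegral_double_wt_le α β x) _)
    have h2 := ENNReal.inv_mul_cancel (wt_ne_zero α (x - y)) (wt_ne_top _ _)
    have h3 := ENNReal.inv_mul_cancel (wt_ne_zero β y) (wt_ne_top _ _)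
    calc _ = ((wt α (x - y))⁻¹ * wt α (x - y)) * ((wt β y)⁻¹ * wt β y) *
          (A (x - y) * B y) ^ 2 := by rw [h2, h3]; ring
      _ = _ := by ring
  refine (lintegral_mono hpt).trans ?_
  rw [lintegral_const_mul, lintegral_lintegral_swap (by fun_prop)]
  · refine le_of_eq ?_
    congr 1
    have : ∀ y, ∫⁻ x, (wt α (x - y) * A (x - y) ^ 2) * (wt β y * B y ^ 2) =
        (∫⁻ x, wt α x * A x ^ 2) * (wt β y * B y ^ 2) := fun y => by
      rw [lintegral_mul_const _ (by fun_prop),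
        lintegral_sub_right_eq_self (μ := volume) (fun x => wt α x * A x ^ 2)]
    simp only [this]
    rw [lintegral_const_mul _ (by fun_prop)]
  · exact Measurable.lintegral_prod_right' (f := fun p : ℝ × ℝ =>
      (wt α (p.1 - p.2) * A (p.1 - p.2) ^ 2) * (wt β p.2 * B p.2 ^ 2)) (by fun_prop)

end

/-! ### Temporal Fourier transforms of square integrable functions -/

/-- Test against a smooth bump equal to one on a ball containing the compact set. -/
theorem locallyIntegrable_of_integrable_mul_schwartz {f : ℝ → ℂ}
    (h : ∀ φ : 𝓢(ℝ, ℂ), Integrable fun t => f t * φ t) : LocallyIntegrable f := by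
  rw [locallyIntegrable_iff]
  intro K hK
  obtain ⟨R, hR⟩ := hK.isBounded.subset_closedBall 0
  let b : ContDiffBump (0 : ℝ) := ⟨max R 1, max R 1 + 1, by positivity, by linarith⟩
  have hb1 : HasCompactSupport (Complex.ofRealCLM ∘ b) := b.hasCompactSupport.comp_left rfl
  have hb2 : ContDiff ℝ ((⊤ : ℕ∞) : WithTop ℕ∞) (Complex.ofRealCLM ∘ b) :=
    Complex.ofRealCLM.contDiff.comp b.contDiff
  refine ((h (hb1.toSchwartzMap hb2)).integrableOn (s := K)).congr_fun (fun x hx => ?_)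
    hK.measurableSet
  have : b x = 1 := b.one_of_mem_closedBall
    (Metric.closedBall_subset_closedBall (le_max_left R 1) (hR hx))
  simp [this]

theorem ae_eq_of_integral_mul_schwartz_eq {f g : ℝ → ℂ} (hf : LocallyIntegrable f)
    (hg : LocallyIntegrable g) (h : ∀ φ : 𝓢(ℝ, ℂ), ∫ t, f t * φ t = ∫ t, g t * φ t) :
    f =ᵐ[volume] g := by
  refine ae_eq_of_integral_contDiff_smul_eq hf hg fun b hb hbc => ?_
  have hb1 : HasCompactSupport (Complex.ofRealCLM ∘ b) := hbc.comp_left rfl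
  have hb2 : ContDiff ℝ ((⊤ : ℕ∞) : WithTop ℕ∞) (Complex.ofRealCLM ∘ b) :=
    Complex.ofRealCLM.contDiff.comp hb
  have := h (hb1.toSchwartzMap hb2)
  simpa [mul_comm] using this

theorem integral_fourier_Lp_mul_schwartz (F : Lp (α := ℝ) ℂ 2) (φ : 𝓢(ℝ, ℂ)) :
    ∫ x, (𝓕 F : Lp (α := ℝ) ℂ 2) x * φ x = ∫ x, F x * (𝓕 φ : 𝓢(ℝ, ℂ)) x := by
  have := congrArg (fun T : TemperedDistribution ℝ ℂ => T φ)
    (Lp.fourier_toTemperedDistribution_eq F)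
  simp only [TemperedDistribution.fourier_apply, Lp.toTemperedDistribution_apply,
    smul_eq_mul] at this
  simpa only [mul_comm] using this.symm

theorem integral_fourierInv_Lp_mul_schwartz (F : Lp (α := ℝ) ℂ 2) (φ : 𝓢(ℝ, ℂ)) :
    ∫ x, (𝓕⁻ F : Lp (α := ℝ) ℂ 2) x * φ x = ∫ x, F x * (𝓕⁻ φ : 𝓢(ℝ, ℂ)) x := by
  have := congrArg (fun T : TemperedDistribution ℝ ℂ => T φ)
    (Lp.fourierInv_toTemperedDistribution_eq F)
  simp only [TemperedDistribution.fourierInv_apply, Lp.toTemperedDistribution_apply,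
    smul_eq_mul] at this
  simpa only [mul_comm] using this.symm

/-- The bilinear form of Plancherel, without conjugation. Both sides are continuous in `H`, so the
Schwartz case extends by density. -/
theorem integral_mul_fourier_Lp (F H : Lp (α := ℝ) ℂ 2) :
    ∫ x, F x * (𝓕 H : Lp (α := ℝ) ℂ 2) x = ∫ x, (𝓕 F : Lp (α := ℝ) ℂ 2) x * H x := by
  let P : Lp (α := ℝ) ℂ 2 →L[ℂ] Lp (α := ℝ) ℂ 2 →L[ℂ] ℂ :=
    (ContinuousLinearMap.mul ℂ ℂ).lpPairing volume 2 2
  have hP : ∀ F H : Lp (α := ℝ) ℂ 2, P F H = ∫ x, F x * H x := fun F H => by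
    simp only [P, ContinuousLinearMap.lpPairing_eq_integral]; rfl
  have hPs : ∀ (F : Lp (α := ℝ) ℂ 2) (φ : 𝓢(ℝ, ℂ)),
      P F (SchwartzMap.toLpCLM ℝ ℂ 2 volume φ) = ∫ x, F x * φ x := fun F φ => by
    rw [hP]
    exact integral_congr_ae ((φ.coeFn_toLp 2 volume).mono fun x hx => congrArg (F x * ·) hx)
  have hc : Continuous fun H : Lp (α := ℝ) ℂ 2 => (𝓕 H : Lp (α := ℝ) ℂ 2) :=
    FourierTransform.continuous_fourier
  rw [← hP, ← hP]
  refine DenseRange.induction_on (p := fun H : Lp (α := ℝ) ℂ 2 => P F (𝓕 H) = P (𝓕 F) H)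
    (SchwartzMap.denseRange_toLpCLM (p := 2) ENNReal.ofNat_ne_top) H ?_ ?_
  · exact isClosed_eq ((P F).continuous.comp hc) (P (𝓕 F)).continuous
  · intro φ
    have h1 : 𝓕 (SchwartzMap.toLpCLM ℝ ℂ 2 volume φ) =
      SchwartzMap.toLpCLM ℝ ℂ 2 volume (𝓕 φ) := SchwartzMap.toLp_fourier_eq φ
    rw [h1, hPs, hPs, integral_fourier_Lp_mul_schwartz]

namespace IsTimeFourier

variable {f g f' g' : ℝ → ℂ}

theorem locallyIntegrable_left (h : IsTimeFourier f g) : LocallyIntegrable f :=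
  locallyIntegrable_of_integrable_mul_schwartz fun φ => by
    simpa using (h (𝓕⁻ φ)).1

theorem locallyIntegrable_right (h : IsTimeFourier f g) : LocallyIntegrable g :=
  locallyIntegrable_of_integrable_mul_schwartz fun φ => (h φ).2.1

theorem congr_right (h : IsTimeFourier f g) (hg : g =ᵐ[volume] g') : IsTimeFourier f g' := by
  intro φ
  have hφ : (fun τ => g τ * φ τ) =ᵐ[volume] fun τ => g' τ * φ τ :=
    hg.mono fun x hx => by simp only [hx]
  exact ⟨(h φ).1, (h φ).2.1.congr hφ, (h φ).2.2.trans (integral_congr_ae hφ)⟩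

theorem const_mul (h : IsTimeFourier f g) (c : ℂ) :
    IsTimeFourier (fun t => c * f t) fun τ => c * g τ := by
  intro φ
  simp only [mul_assoc]
  refine ⟨(h φ).1.const_mul c, (h φ).2.1.const_mul c, ?_⟩
  rw [integral_const_mul, integral_const_mul, (h φ).2.2]

theorem sub (h : IsTimeFourier f g) (h' : IsTimeFourier f' g') :
    IsTimeFourier (fun t => f t - f' t) fun τ => g τ - g' τ := by
  intro φ
  simp only [sub_mul]
  refine ⟨(h φ).1.sub (h' φ).1, (h φ).2.1.sub (h' φ).2.1, ?_⟩
  rw [integral_sub (h φ).1 (h' φ).1, integral_sub (h φ).2.1 (h' φ).2.1, (h φ).2.2, (h' φ).2.2]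

/-- When the transform is square integrable, the distributional definition agrees with the
Plancherel transform: `f` and the inverse transform of `g` have the same pairings with Schwartz
functions. -/
theorem exists_Lp (h : IsTimeFourier f g) (hg : MemLp g 2) :
    ∃ F : Lp (α := ℝ) ℂ 2, f =ᵐ[volume] F ∧ g =ᵐ[volume] (𝓕 F : Lp (α := ℝ) ℂ 2) := by
  refine ⟨𝓕⁻ (hg.toLp g), ?_, ?_⟩
  · refine ae_eq_of_integral_mul_schwartz_eq h.locallyIntegrable_left
      ((Lp.memLp _).locallyIntegrable (by norm_num)) fun φ => ?_
    rw [integral_fourierInv_Lp_mul_schwartz]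
    have := (h (𝓕⁻ φ)).2.2
    rw [FourierTransform.fourier_fourierInv_eq] at this
    rw [this]
    exact integral_congr_ae (hg.coeFn_toLp.mono fun x hx => by simp only [hx])
  · rw [FourierTransform.fourier_fourierInv_eq]
    exact hg.coeFn_toLp.symm

theorem memLp_left (h : IsTimeFourier f g) (hg : MemLp g 2) : MemLp f 2 := by
  obtain ⟨F, hF, -⟩ := h.exists_Lp hg
  exact (memLp_congr_ae hF).2 (Lp.memLp F)

theorem eLpNorm_eq (h : IsTimeFourier f g) (hg : MemLp g 2) :
    eLpNorm f 2 volume = eLpNorm g 2 volume := by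
  obtain ⟨F, hF, hF'⟩ := h.exists_Lp hg
  rw [eLpNorm_congr_ae hF, eLpNorm_congr_ae hF', ← Lp.enorm_def, ← Lp.enorm_def]
  simp [enorm, nnnorm]

theorem lintegral_sq_eq (h : IsTimeFourier f g) (hg : MemLp g 2) :
    ∫⁻ t, ‖f t‖ₑ ^ 2 = ∫⁻ τ, ‖g τ‖ₑ ^ 2 := by
  have := h.eLpNorm_eq hg
  rw [eLpNorm_eq_lintegral_rpow_enorm_toReal (by norm_num) (by norm_num),
    eLpNorm_eq_lintegral_rpow_enorm_toReal (by norm_num) (by norm_num)] at this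
  have h2 := (ENNReal.rpow_left_injective (by norm_num : (1 / (2 : ℝ≥0∞).toReal : ℝ) ≠ 0)) this
  simpa using h2

theorem integral_mul_fourier_Lp_eq (h : IsTimeFourier f g) (hg : MemLp g 2)
    (H : Lp (α := ℝ) ℂ 2) :
    ∫ x, f x * (𝓕 H : Lp (α := ℝ) ℂ 2) x = ∫ x, g x * H x := by
  obtain ⟨F, hF, hF'⟩ := h.exists_Lp hg
  refine Eq.trans ?_ ((integral_mul_fourier_Lp F H).trans ?_)
  · exact integral_congr_ae (hF.mono fun x hx => by simp only [hx])
  · exact integral_congr_ae (hF'.symm.mono fun x hx => by simp only [hx])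

end IsTimeFourier

theorem memLp_two_iff {f : ℝ → ℂ} (hf : AEStronglyMeasurable f volume) :
    MemLp f 2 volume ↔ ∫⁻ x, ‖f x‖ₑ ^ 2 < ∞ := by
  rw [MemLp, and_iff_right hf, eLpNorm_lt_top_iff_lintegral_rpow_enorm_lt_top (by norm_num)
    (by norm_num)]
  simp

/-- A kernel `a(e x s) b(s) c(x)` with `a, b` square integrable and `c` integrable is
integrable. -/
theorem integrable_kernel {a b c : ℝ → ℂ} {e : ℝ → ℝ → ℝ} (he : Measurable fun p : ℝ × ℝ => e p.1 p.2)
    (he' : ∀ x, MeasurePreserving (e x) volume volume) (ha : Measurable a) (hb : Measurable b)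
    (ha' : MemLp a 2) (hb' : MemLp b 2) (hc : Measurable c) (hc' : Integrable c) :
    Integrable (fun p : ℝ × ℝ => a (e p.1 p.2) * b p.2 * c p.1) (volume.prod volume) := by
  have hm : Measurable fun p : ℝ × ℝ => a (e p.1 p.2) * b p.2 * c p.1 := by fun_prop
  refine ⟨hm.aestronglyMeasurable, ?_⟩
  rw [HasFiniteIntegral, lintegral_prod _ (by fun_prop)]
  have ha2 := (memLp_two_iff ha.aestronglyMeasurable).1 ha'
  have hb2 := (memLp_two_iff hb.aestronglyMeasurable).1 hb'
  set P := (∫⁻ x, ‖a x‖ₑ ^ 2) * ∫⁻ x, ‖b x‖ₑ ^ 2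
  have hP : P < ∞ := ENNReal.mul_lt_top ha2 hb2
  have h1 : ∀ x, ∫⁻ s, ‖a (e x s) * b s‖ₑ ≤ P ^ (1 / 2 : ℝ) := by
    intro x
    have h2 : (∫⁻ s, ‖a (e x s) * b s‖ₑ) ^ 2 ≤ P := by
      refine (lintegral_sq_le_mul (p := fun s => ‖a (e x s)‖ₑ ^ 2) (q := fun s => ‖b s‖ₑ ^ 2)
        (by fun_prop) (by fun_prop) fun s => ?_).trans ?_
      · rw [enorm_mul, mul_pow]
      · rw [(he' x).lintegral_comp (f := fun y => ‖a y‖ₑ ^ 2) (by fun_prop)]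
    have h3 := ENNReal.rpow_le_rpow h2 (by norm_num : (0 : ℝ) ≤ 1 / 2)
    rwa [← ENNReal.rpow_natCast, ← ENNReal.rpow_mul,
      show ((2 : ℕ) : ℝ) * (1 / 2) = 1 by norm_num, ENNReal.rpow_one] at h3
  calc ∫⁻ x, ∫⁻ s, ‖a (e x s) * b s * c x‖ₑ
      ≤ ∫⁻ x, P ^ (1 / 2 : ℝ) * ‖c x‖ₑ := by
        refine lintegral_mono fun x => ?_
        simp only [enorm_mul _ (c x)]
        rw [lintegral_mul_const _ (by fun_prop)]
        gcongr
        exact h1 x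
    _ = P ^ (1 / 2 : ℝ) * ∫⁻ x, ‖c x‖ₑ := lintegral_const_mul _ (by fun_prop)
    _ < ∞ := ENNReal.mul_lt_top (ENNReal.rpow_lt_top_of_nonneg (by norm_num) hP.ne) hc'.2

/-! ### Temporal Fourier transforms of products and sums -/

theorem memLp_schwartz_two (φ : 𝓢(ℝ, ℂ)) : MemLp φ 2 volume := φ.memLp 2 volume

/-- The inverse Fourier transform of `f · 𝓕 φ`, where `f` has the transform `g`. -/
theorem IsTimeFourier.integral_mul_fourier_mul_fourierInv {f g : ℝ → ℂ} (h : IsTimeFourier f g)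
    (hg : MemLp g 2) (hgm : Measurable g) (φ ψ : 𝓢(ℝ, ℂ)) :
    ∫ t, f t * (𝓕 φ : 𝓢(ℝ, ℂ)) t * (𝓕⁻ ψ : 𝓢(ℝ, ℂ)) t =
      ∫ s, (∫ τ, φ (s + τ) * g τ) * ψ s := by
  -- The reflection of `ψ`. With it `𝓕 φ · 𝓕⁻ ψ` becomes `𝓕 φ · 𝓕 ψ'`, the transform of a
  -- convolution, and the definition of `IsTimeFourier` applies to that convolution.
  set ψ' : 𝓢(ℝ, ℂ) := 𝓕⁻ (𝓕⁻ ψ)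
  have hψ' : ∀ x, ψ' x = ψ (-x) := fun x => by
    simp only [ψ']
    rw [SchwartzMap.fourierInv_coe, Real.fourierInv_eq_fourier_neg, ← SchwartzMap.fourier_coe,
      FourierTransform.fourier_fourierInv_eq]
  have hconv := SchwartzMap.fourier_convolution (ContinuousLinearMap.mul ℂ ℂ) φ ψ'
  have hpt : ∀ t, (𝓕 φ : 𝓢(ℝ, ℂ)) t * (𝓕⁻ ψ : 𝓢(ℝ, ℂ)) t =
      (𝓕 (SchwartzMap.convolution (ContinuousLinearMap.mul ℂ ℂ) φ ψ') : 𝓢(ℝ, ℂ)) t := fun t => by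
    rw [hconv]
    simp [ψ', SchwartzMap.pairing_apply_apply]
  simp only [mul_assoc, hpt]
  rw [(h _).2.2]
  have hcv : ∀ x, SchwartzMap.convolution (ContinuousLinearMap.mul ℂ ℂ) φ ψ' x =
      ∫ s, φ (s + x) * ψ s := fun x => by
    rw [SchwartzMap.convolution_apply, MeasureTheory.convolution_def,
      ← integral_add_right_eq_self (μ := volume) _ x]
    refine integral_congr_ae (Filter.Eventually.of_forall fun s => ?_)
    simp only [ContinuousLinearMap.mul_apply', hψ']
    congr 2
    ring
  simp only [hcv]
  have hint := integrable_kernel (a := φ) (b := g) (c := ψ) (e := fun s τ => s + τ)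
    (by fun_prop) (fun s => measurePreserving_add_left volume s) φ.continuous.measurable hgm
    (memLp_schwartz_two φ) hg ψ.continuous.measurable ψ.integrable
  calc ∫ x, g x * ∫ s, φ (s + x) * ψ s = ∫ x, ∫ s, φ (s + x) * g x * ψ s := by
        refine integral_congr_ae (Filter.Eventually.of_forall fun x => ?_)
        simp only
        rw [← integral_const_mul]
        refine integral_congr_ae (Filter.Eventually.of_forall fun s => ?_)
        simp only
        ring
    _ = ∫ s, ∫ x, φ (s + x) * g x * ψ s := (integral_integral_swap hint).symm
    _ = _ := by simp only [integral_mul_const]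

/-- The Fourier transform of a product of square integrable functions is a convolution. -/
theorem IsTimeFourier.mul {f g f' g' : ℝ → ℂ} (h : IsTimeFourier f g) (hg : MemLp g 2)
    (hgm : Measurable g) (h' : IsTimeFourier f' g') (hg' : MemLp g' 2) (hgm' : Measurable g') :
    IsTimeFourier (fun t => f t * f' t) fun τ => ∫ s, g (τ - s) * g' s := by
  intro φ
  have hf := h.memLp_left hg
  have hf' := h'.memLp_left hg'
  have hq : MemLp (fun t => f t * (𝓕 φ : 𝓢(ℝ, ℂ)) t) 2 volume :=
    ((𝓕 φ : 𝓢(ℝ, ℂ)).memLp ⊤ volume).mul hf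
  have hker := integrable_kernel (a := g) (b := g') (c := φ) (e := fun x s => x - s)
    (by fun_prop) (fun x => Measure.measurePreserving_sub_left volume x) hgm hgm' hg hg'
    φ.continuous.measurable φ.integrable
  refine ⟨?_, ?_, ?_⟩
  · refine (hq.integrable_mul hf').congr (Filter.Eventually.of_forall fun t => ?_)
    simp only [Pi.mul_apply]
    ring
  · simpa only [integral_mul_const] using hker.integral_prod_left
  -- Write `f · 𝓕 φ` as the transform of a square integrable `H`, so that Plancherel moves the
  -- transform onto `f'`. Testing against Schwartz functions identifies `H` with a correlation of
  -- `φ` and `g`, and Fubini then gives the convolution.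
  · set H : Lp (α := ℝ) ℂ 2 volume := 𝓕⁻ (hq.toLp _)
    have hH : H =ᵐ[volume] fun s => ∫ τ, φ (s + τ) * g τ := by
      have hloc : LocallyIntegrable fun s => ∫ τ, φ (s + τ) * g τ :=
        locallyIntegrable_of_integrable_mul_schwartz fun ψ => by
          have hint := integrable_kernel (a := φ) (b := g) (c := ψ) (e := fun s τ => s + τ)
            (by fun_prop) (fun s => measurePreserving_add_left volume s)
            φ.continuous.measurable hgm (memLp_schwartz_two φ) hg ψ.continuous.measurable
            ψ.integrable
          simpa only [integral_mul_const] using hint.integral_prod_left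
      refine ae_eq_of_integral_mul_schwartz_eq ((Lp.memLp _).locallyIntegrable (by norm_num)) hloc
        fun ψ => ?_
      rw [integral_fourierInv_Lp_mul_schwartz, ← h.integral_mul_fourier_mul_fourierInv hg hgm φ ψ]
      exact integral_congr_ae (hq.coeFn_toLp.mono fun x hx => by simp only [hx])
    have h1 := h'.integral_mul_fourier_Lp_eq hg' H
    simp only [H, FourierTransform.fourier_fourierInv_eq] at h1
    calc ∫ t, f t * f' t * (𝓕 φ : 𝓢(ℝ, ℂ)) t
        = ∫ t, f' t * (hq.toLp _ : Lp (α := ℝ) ℂ 2 volume) t :=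
          integral_congr_ae (hq.coeFn_toLp.mono fun x hx => by simp only [hx]; ring)
      _ = ∫ s, g' s * H s := h1
      _ = ∫ s, g' s * ∫ τ, φ (s + τ) * g τ :=
          integral_congr_ae (hH.mono fun x hx => by simp only [hx])
      _ = ∫ s, ∫ x, g (x - s) * g' s * φ x := by
          refine integral_congr_ae (Filter.Eventually.of_forall fun s => ?_)
          simp only
          rw [← integral_const_mul, ← integral_sub_right_eq_self (μ := volume) _ s]
          refine integral_congr_ae (Filter.Eventually.of_forall fun x => ?_)
          simp only [add_sub_cancel]
          ring
      _ = ∫ x, ∫ s, g (x - s) * g' s * φ x := (integral_integral_swap hker).symm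
      _ = _ := by simp only [integral_mul_const]

/-- The convolution theorem applied twice. The pointwise bound feeds the quantitative estimates; the
last identity carries square integrability back to the time side, where convergence of the sum is
decided. -/
theorem exists_isTimeFourier_triple {f₁ f₂ f₃ g₁ g₂ g₃ : ℝ → ℂ} (h₁ : IsTimeFourier f₁ g₁)
    (h₂ : IsTimeFourier f₂ g₂) (h₃ : IsTimeFourier f₃ g₃) (m₁ : Measurable g₁)
    (m₂ : Measurable g₂) (m₃ : Measurable g₃) {α₁ α₂ α₃ : ℝ}
    (n₁ : ∫⁻ y, wt α₁ y * ‖g₁ y‖ₑ ^ 2 < ∞) (n₂ : ∫⁻ y, wt α₂ y * ‖g₂ y‖ₑ ^ 2 < ∞)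
    (n₃ : ∫⁻ y, wt α₃ y * ‖g₃ y‖ₑ ^ 2 < ∞) :
    ∃ T : ℝ → ℂ, Measurable T ∧ IsTimeFourier (fun t => f₁ t * f₂ t * f₃ t) T ∧
      (∀ x, ‖T x‖ₑ ≤ conv3 (fun y => ‖g₁ y‖ₑ) (fun y => ‖g₂ y‖ₑ) (fun y => ‖g₃ y‖ₑ) x) ∧
      ∫⁻ t, ‖f₁ t * f₂ t * f₃ t‖ₑ ^ 2 = ∫⁻ x, ‖T x‖ₑ ^ 2 := by
  have hmem : ∀ {g : ℝ → ℂ} {α : ℝ}, Measurable g → ∫⁻ y, wt α y * ‖g y‖ₑ ^ 2 < ∞ →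
      MemLp g 2 volume := fun {g α} hm hn =>
    (memLp_two_iff hm.aestronglyMeasurable).2 <| (lintegral_mono fun y => by
      simpa using mul_le_mul_left (one_le_wt α y) (‖g y‖ₑ ^ 2)).trans_lt hn
  set g₁₂ : ℝ → ℂ := fun x => ∫ y, g₁ (x - y) * g₂ y
  have m₁₂ : Measurable g₁₂ := by
    refine (StronglyMeasurable.integral_prod_right
      (f := fun x y => g₁ (x - y) * g₂ y) ?_).measurable
    exact Measurable.stronglyMeasurable (by fun_prop)
  have h₁₂ : IsTimeFourier (fun t => f₁ t * f₂ t) g₁₂ :=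
    h₁.mul (hmem m₁ n₁) m₁ h₂ (hmem m₂ n₂) m₂
  have e₁₂ : ∀ x, ‖g₁₂ x‖ₑ ≤ ∫⁻ y, ‖g₁ (x - y)‖ₑ * ‖g₂ y‖ₑ := fun x => by
    refine (enorm_integral_le_lintegral_enorm _).trans (le_of_eq ?_)
    simp only [enorm_mul]
  have n₁₂ : MemLp g₁₂ 2 volume := by
    refine (memLp_two_iff m₁₂.aestronglyMeasurable).2 ?_
    refine (lintegral_mono fun x => pow_le_pow_left' (e₁₂ x) 2).trans_lt ?_
    refine (lintegral_conv2_sq_le (A := fun y => ‖g₁ y‖ₑ) (B := fun y => ‖g₂ y‖ₑ)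
      (by fun_prop) (by fun_prop) α₁ α₂).trans_lt ?_
    exact ENNReal.mul_lt_top (ENNReal.mul_lt_top (by norm_num) kap_lt_top)
      (ENNReal.mul_lt_top n₁ n₂)
  set T : ℝ → ℂ := fun x => ∫ y, g₁₂ (x - y) * g₃ y
  have mT : Measurable T := by
    refine (StronglyMeasurable.integral_prod_right
      (f := fun x y => g₁₂ (x - y) * g₃ y) ?_).measurable
    exact Measurable.stronglyMeasurable (by fun_prop)
  have hT : IsTimeFourier (fun t => f₁ t * f₂ t * f₃ t) T :=
    h₁₂.mul n₁₂ m₁₂ h₃ (hmem m₃ n₃) m₃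
  have eT : ∀ x, ‖T x‖ₑ ≤
      conv3 (fun y => ‖g₁ y‖ₑ) (fun y => ‖g₂ y‖ₑ) (fun y => ‖g₃ y‖ₑ) x := fun x => by
    refine (enorm_integral_le_lintegral_enorm _).trans ?_
    rw [conv3, Measure.volume_eq_prod, lintegral_prod _ (by fun_prop)]
    refine lintegral_mono fun y => ?_
    simp only [enorm_mul]
    rw [lintegral_mul_const _ (by fun_prop)]
    gcongr
    exact e₁₂ _
  refine ⟨T, mT, hT, eT, hT.lintegral_sq_eq ?_⟩
  refine (memLp_two_iff mT.aestronglyMeasurable).2 ?_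
  refine (lintegral_mono fun x => pow_le_pow_left' (eT x) 2).trans_lt ?_
  refine (lintegral_conv3_sq_le (by fun_prop) (by fun_prop) (by fun_prop) α₁ α₂ α₃).trans_lt ?_
  exact ENNReal.mul_lt_top (ENNReal.mul_lt_top (by norm_num) (ENNReal.pow_lt_top kap_lt_top))
    (ENNReal.mul_lt_top (ENNReal.mul_lt_top n₁ n₂) n₃)

theorem ae_summable_of_lintegral_tsum_sq_lt_top {ι : Type*} [Countable ι] {f : ι → ℝ → ℂ}
    (hf : ∀ i, AEStronglyMeasurable (f i) volume)
    (h : ∫⁻ t, (∑' i, ‖f i t‖ₑ) ^ 2 < ∞) : ∀ᵐ t, Summable fun i => f i t := by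
  have hm : AEMeasurable (fun t => (∑' i, ‖f i t‖ₑ) ^ 2) volume :=
    (AEMeasurable.tsum fun i => (hf i).enorm).pow_const 2
  filter_upwards [ae_lt_top' hm h.ne] with t ht
  have : ∑' i, ‖f i t‖ₑ ≠ ∞ := fun h0 => by simp [h0] at ht
  exact Summable.of_enorm this

theorem aestronglyMeasurable_tsum {ι : Type*} [Countable ι] {f : ι → ℝ → ℂ}
    (hf : ∀ i, AEStronglyMeasurable (f i) volume) (h : ∀ᵐ t, Summable fun i => f i t) :
    AEStronglyMeasurable (fun t => ∑' i, f i t) volume :=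
  aestronglyMeasurable_of_tendsto_ae Filter.atTop
    (f := fun (s : Finset ι) t => ∑ i ∈ s, f i t)
    (fun s => Finset.aestronglyMeasurable_fun_sum s fun i _ => hf i)
    (h.mono fun _ ht => ht.hasSum)

theorem integrable_tsum_mul {ι : Type*} [Countable ι] {f : ι → ℝ → ℂ}
    (hf : ∀ i, AEStronglyMeasurable (f i) volume) (h : ∫⁻ t, (∑' i, ‖f i t‖ₑ) ^ 2 < ∞)
    {φ : ℝ → ℂ} (hφ : MemLp φ 2 volume) :
    Integrable (fun t => (∑' i, f i t) * φ t) ∧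
      HasSum (fun i => ∫ t, f i t * φ t) (∫ t, (∑' i, f i t) * φ t) := by
  have hs := ae_summable_of_lintegral_tsum_sq_lt_top hf h
  have hsum : ∫⁻ t, (∑' i, ‖f i t‖ₑ) * ‖φ t‖ₑ < ∞ := by
    have h1 : (∫⁻ t, (∑' i, ‖f i t‖ₑ) * ‖φ t‖ₑ) ^ 2 < ∞ :=
      (lintegral_sq_le_mul (p := fun t => (∑' i, ‖f i t‖ₑ) ^ 2) (q := fun t => ‖φ t‖ₑ ^ 2)
        ((AEMeasurable.tsum fun i => (hf i).enorm).pow_const 2)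
        (hφ.1.enorm.pow_const 2) fun t => (mul_pow _ _ 2).le).trans_lt
        (ENNReal.mul_lt_top h ((memLp_two_iff hφ.1).1 hφ))
    exact lt_of_not_ge fun h0 => by simp [top_le_iff.1 h0] at h1
  have hle : ∀ t, ‖(∑' i, f i t) * φ t‖ₑ ≤ (∑' i, ‖f i t‖ₑ) * ‖φ t‖ₑ := fun t => by
    rw [enorm_mul]
    gcongr
    exact enorm_tsum_le_tsum_enorm
  have hint : ∑' i, ∫⁻ t, ‖f i t * φ t‖ₑ < ∞ := by
    rw [← lintegral_tsum (f := fun i t => ‖f i t * φ t‖ₑ) fun i => ((hf i).mul hφ.1).enorm]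
    simpa only [enorm_mul, ENNReal.tsum_mul_right] using hsum
  have hi : ∀ i, Integrable fun t => f i t * φ t := fun i =>
    ⟨(hf i).mul hφ.1, (ENNReal.le_tsum i).trans_lt hint⟩
  refine ⟨⟨(aestronglyMeasurable_tsum hf hs).mul hφ.1, (lintegral_mono hle).trans_lt hsum⟩, ?_⟩
  have hnorm : Summable fun i => ∫ t, ‖f i t * φ t‖ := by
    have := ENNReal.summable_toReal hint.ne
    refine this.congr fun i => ?_
    rw [integral_norm_eq_lintegral_enorm (hi i).1]
  have key := hasSum_integral_of_summable_integral_norm hi hnorm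
  simpa only [tsum_mul_right] using key

/-- Square integrability of the sums of absolute values allows summation and integration against a
Schwartz function to be exchanged on both sides. -/
theorem isTimeFourier_tsum {ι : Type*} [Countable ι] {f g : ι → ℝ → ℂ}
    (h : ∀ i, IsTimeFourier (f i) (g i)) (hf : ∫⁻ t, (∑' i, ‖f i t‖ₑ) ^ 2 < ∞)
    (hg : ∫⁻ t, (∑' i, ‖g i t‖ₑ) ^ 2 < ∞) :
    IsTimeFourier (fun t => ∑' i, f i t) fun τ => ∑' i, g i τ := by
  intro φ
  have h1 := integrable_tsum_mul (fun i => (h i).locallyIntegrable_left.aestronglyMeasurable) hf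
    (memLp_schwartz_two (𝓕 φ))
  have h2 := integrable_tsum_mul (fun i => (h i).locallyIntegrable_right.aestronglyMeasurable) hg
    (memLp_schwartz_two φ)
  refine ⟨h1.1, h2.1, h1.2.unique ?_⟩
  simp only [fun i => (h i φ).2.2]
  exact h2.2

/-! ### The frequency multiplier -/

/-- The product is `z x^(-δ) y^(-δ) ≥ z (Cz)^(-2δ)`, and `2δ ≤ 1` makes this at least `1/C`. Thus a
dominant third factor pays for the excess of the exponents over one. -/
theorem one_le_mul_rpow_neg {x y z C δ : ℝ} (hx : 0 < x) (hy : 0 < y) (hz : 1 ≤ z) (hC : 1 ≤ C)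
    (hxz : x ≤ C * z) (hyz : y ≤ C * z) (hδ : 0 ≤ δ) (hδ' : δ ≤ 1 / 2) :
    1 ≤ C * (x * y * z * (x ^ (-(1 + δ)) * y ^ (-(1 + δ)))) := by
  have hCz : 1 ≤ C * z := one_le_mul_of_one_le_of_one_le hC hz
  have hCz0 : 0 < C * z := by linarith
  have key : ∀ t : ℝ, 0 < t → t ≤ C * z → (C * z) ^ (-δ) ≤ t * t ^ (-(1 + δ)) := by
    intro t ht htz
    have h1 : t * t ^ (-(1 + δ)) = t ^ (-δ) := by
      nth_rw 1 [← Real.rpow_one t]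
      rw [← Real.rpow_add ht]
      ring_nf
    rw [h1]
    exact Real.rpow_le_rpow_of_nonpos ht htz (by linarith)
  have h2 : (C * z)⁻¹ ≤ (C * z) ^ (-δ) * (C * z) ^ (-δ) := by
    rw [← Real.rpow_add hCz0, ← Real.rpow_neg_one]
    exact Real.rpow_le_rpow_of_exponent_le hCz (by linarith)
  have h3 : (C * z) ^ (-δ) * (C * z) ^ (-δ) ≤
      (x * x ^ (-(1 + δ))) * (y * y ^ (-(1 + δ))) :=
    mul_le_mul (key x hx hxz) (key y hy hyz) (by positivity) (by positivity)
  calc 1 = (C * z) * (C * z)⁻¹ := (mul_inv_cancel₀ hCz0.ne').symm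
    _ ≤ (C * z) * ((x * x ^ (-(1 + δ))) * (y * y ^ (-(1 + δ)))) := by
        gcongr
        exact h2.trans h3
    _ = _ := by ring

/-- A sum of products of two powers `⟨kᵢ⟩^{-p}` or `|kᵢ + kⱼ|^{-p}` with linearly independent
arguments, symmetric in the three frequencies. -/
def freqWeight (p k₁ k₂ k₃ : ℝ) : ℝ :=
  (bracket k₁ ^ (-p) * bracket k₂ ^ (-p) + bracket k₂ ^ (-p) * bracket k₃ ^ (-p) +
    bracket k₁ ^ (-p) * bracket k₃ ^ (-p)) +
  (|k₁ + k₂| ^ (-p) * |k₂ + k₃| ^ (-p) + |k₂ + k₃| ^ (-p) * |k₃ + k₁| ^ (-p) +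
    |k₁ + k₂| ^ (-p) * |k₃ + k₁| ^ (-p)) +
  (|k₁ + k₂| ^ (-p) * bracket k₁ ^ (-p) + |k₁ + k₂| ^ (-p) * bracket k₂ ^ (-p)) +
  (|k₂ + k₃| ^ (-p) * bracket k₂ ^ (-p) + |k₂ + k₃| ^ (-p) * bracket k₃ ^ (-p)) +
  (|k₃ + k₁| ^ (-p) * bracket k₁ ^ (-p) + |k₃ + k₁| ^ (-p) * bracket k₃ ^ (-p))

theorem freqWeight_swap_left (p k₁ k₂ k₃ : ℝ) :
    freqWeight p k₂ k₁ k₃ = freqWeight p k₁ k₂ k₃ := by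
  unfold freqWeight
  rw [add_comm k₂ k₁, add_comm k₁ k₃, add_comm k₃ k₂]
  ring

theorem freqWeight_swap_outer (p k₁ k₂ k₃ : ℝ) :
    freqWeight p k₃ k₂ k₁ = freqWeight p k₁ k₂ k₃ := by
  unfold freqWeight
  rw [add_comm k₃ k₂, add_comm k₂ k₁, add_comm k₁ k₃]
  ring

theorem freqWeight_pos (p k₁ k₂ k₃ : ℝ) : 0 < freqWeight p k₁ k₂ k₃ := by
  have h1 := bracket_pos k₁
  have h2 := bracket_pos k₂
  have h3 := bracket_pos k₃
  unfold freqWeight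
  positivity

/-- Only these four of the twelve summands are needed once the frequencies are ordered; the rest
make the weight symmetric. -/
theorem pair_le_freqWeight (p k₁ k₂ k₃ : ℝ) :
    bracket k₁ ^ (-p) * bracket k₂ ^ (-p) ≤ freqWeight p k₁ k₂ k₃ ∧
    |k₂ + k₃| ^ (-p) * bracket k₂ ^ (-p) ≤ freqWeight p k₁ k₂ k₃ ∧
    |k₂ + k₃| ^ (-p) * bracket k₃ ^ (-p) ≤ freqWeight p k₁ k₂ k₃ ∧
    |k₁ + k₂| ^ (-p) * |k₂ + k₃| ^ (-p) ≤ freqWeight p k₁ k₂ k₃ := by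
  have u₁ := Real.rpow_nonneg (bracket_pos k₁).le (-p)
  have u₂ := Real.rpow_nonneg (bracket_pos k₂).le (-p)
  have u₃ := Real.rpow_nonneg (bracket_pos k₃).le (-p)
  have v₁ := Real.rpow_nonneg (abs_nonneg (k₁ + k₂)) (-p)
  have v₂ := Real.rpow_nonneg (abs_nonneg (k₂ + k₃)) (-p)
  have v₃ := Real.rpow_nonneg (abs_nonneg (k₃ + k₁)) (-p)
  have a₁ := mul_nonneg u₁ u₂
  have a₂ := mul_nonneg u₂ u₃
  have a₃ := mul_nonneg u₁ u₃
  have b₁ := mul_nonneg v₁ v₂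
  have b₂ := mul_nonneg v₂ v₃
  have b₃ := mul_nonneg v₁ v₃
  have c₁ := mul_nonneg v₁ u₁
  have c₂ := mul_nonneg v₁ u₂
  have c₃ := mul_nonneg v₂ u₂
  have c₄ := mul_nonneg v₂ u₃
  have c₅ := mul_nonneg v₃ u₁
  have c₆ := mul_nonneg v₃ u₃
  unfold freqWeight
  refine ⟨?_, ?_, ?_, ?_⟩ <;> linarith

/-- Let `M = |k₃+k₁|` be the largest pair sum. Then `|k| ≤ 3M/2` and `M ≤ 2|k₁|`. For `M ≥ 1`, of
the three powers of `|k|` on the left one is absorbed by the factor `M` of the resonance and one by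
`⟨k₁⟩`. The last one is bounded by the two smaller pair sums, `⟨k₂⟩`, `⟨k₃⟩` and the weight. -/
theorem multiplier_le_of_max {k₁ k₂ k₃ δ : ℝ} (hδ : 0 ≤ δ) (hδ' : δ ≤ 1 / 2)
    (ha : k₁ + k₂ ≠ 0) (hb : k₂ + k₃ ≠ 0)
    (hac : |k₁ + k₂| ≤ |k₃ + k₁|) (hbc : |k₂ + k₃| ≤ |k₃ + k₁|) (h31 : |k₃| ≤ |k₁|) :
    (k₁ + k₂ + k₃) ^ 2 * bracket (k₁ + k₂ + k₃) ≤
      1000 * ((1 + |(k₁ + k₂) * (k₂ + k₃) * (k₃ + k₁)|) *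
        (bracket k₁ * bracket k₂ * bracket k₃) * freqWeight (1 + δ) k₁ k₂ k₃) := by
  have hB1 := one_le_bracket k₁
  have hB2 := one_le_bracket k₂
  have hB3 := one_le_bracket k₃
  have ha0 : 0 < |k₁ + k₂| := abs_pos.2 ha
  have hb0 : 0 < |k₂ + k₃| := abs_pos.2 hb
  set M := |k₃ + k₁|
  set k := k₁ + k₂ + k₃ with hk
  set w := freqWeight (1 + δ) k₁ k₂ k₃
  have hw : 0 < w := freqWeight_pos _ _ _ _
  obtain ⟨w₁, w₂, w₃, w₄⟩ : _ ∧ _ ∧ _ ∧ _ ≤ w := pair_le_freqWeight (1 + δ) k₁ k₂ k₃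
  have hk1 : |k₁| = bracket k₁ - 1 := by unfold bracket; ring
  have hk2 : |k₂| = bracket k₂ - 1 := by unfold bracket; ring
  have hk3 : |k₃| = bracket k₃ - 1 := by unfold bracket; ring
  have hkk : bracket k = 1 + |k| := rfl
  have hMk1 : M ≤ 2 * |k₁| := by
    have := abs_add_le k₃ k₁
    linarith
  have hkM : 2 * |k| ≤ 3 * M := by
    have e : |2 * k| ≤ |k₁ + k₂| + |k₂ + k₃| + |k₃ + k₁| := by
      rw [show 2 * k = (k₁ + k₂) + (k₂ + k₃) + (k₃ + k₁) by rw [hk]; ring]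
      exact abs_add_three _ _ _
    rw [abs_mul, abs_two] at e
    linarith
  have hsq : k ^ 2 = |k| * |k| := by rw [← sq, sq_abs]
  rcases le_total M 1 with hM | hM
  -- All frequencies involved are bounded here. This case dictates the constant: the left side is at
  -- most `45/8`, the weight at least `(4/49)²`, and their quotient is below `1000`.
  · have hk1' : |k₁| ≤ 5 / 2 := by
      have := abs_sub k (k₂ + k₃)
      rw [show k - (k₂ + k₃) = k₁ by rw [hk]; ring] at this
      linarith
    have hk2' : |k₂| ≤ 5 / 2 := by
      have := abs_sub k (k₃ + k₁)
      rw [show k - (k₃ + k₁) = k₂ by rw [hk]; ring] at this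
      linarith
    have hU : ∀ x : ℝ, |x| ≤ 5 / 2 → 4 / 49 ≤ bracket x ^ (-(1 + δ)) := by
      intro x hx
      have h1 : bracket x ^ (-(2 : ℝ)) ≤ bracket x ^ (-(1 + δ)) :=
        Real.rpow_le_rpow_of_exponent_le (one_le_bracket x) (by linarith)
      refine le_trans ?_ h1
      have h2 : (7 / 2 : ℝ) ^ (-(2 : ℝ)) ≤ bracket x ^ (-(2 : ℝ)) :=
        Real.rpow_le_rpow_of_nonpos (bracket_pos x) (by unfold bracket; linarith) (by norm_num)
      refine le_trans (le_of_eq ?_) h2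
      rw [Real.rpow_neg (by norm_num)]
      norm_num
    have hw1 : (4 / 49 : ℝ) * (4 / 49) ≤ w := by
      have h12 : (4 / 49 : ℝ) * (4 / 49) ≤ bracket k₁ ^ (-(1 + δ)) * bracket k₂ ^ (-(1 + δ)) :=
        mul_le_mul (hU _ hk1') (hU _ hk2') (by norm_num) (by positivity)
      exact h12.trans w₁
    have hl : k ^ 2 * bracket k ≤ 45 / 8 := by
      rw [hsq, hkk]
      have h0 := abs_nonneg k
      have h1 : |k| ≤ 3 / 2 := by linarith
      calc |k| * |k| * (1 + |k|) ≤ (3 / 2) * (3 / 2) * (1 + 3 / 2) := by gcongr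
        _ = 45 / 8 := by norm_num
    have hr : 1 * (1 * 1 * 1) * ((4 / 49 : ℝ) * (4 / 49)) ≤
        (1 + |(k₁ + k₂) * (k₂ + k₃) * (k₃ + k₁)|) * (bracket k₁ * bracket k₂ * bracket k₃) * w := by
      gcongr
      exact le_add_of_nonneg_right (abs_nonneg _)
    linarith
  -- The larger of `⟨k₂⟩`, `⟨k₃⟩` dominates `|k₂+k₃|` up to a factor `2` and plays the role of `z`.
  · have i1 : 1 ≤ 2 * (|k₂ + k₃| * bracket k₂ * bracket k₃ * w) := by
      have hbb : |k₂ + k₃| ≤ |k₂| + |k₃| := abs_add_le _ _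
      have p2 := bracket_pos k₂
      have p3 := bracket_pos k₃
      rcases le_total (bracket k₂) (bracket k₃) with h | h
      · exact (one_le_mul_rpow_neg hb0 p2 hB3 one_le_two (by linarith)
          (by linarith) hδ hδ').trans (by gcongr)
      · refine (one_le_mul_rpow_neg hb0 p3 hB2 one_le_two (by linarith)
          (by linarith) hδ hδ').trans ?_
        rw [mul_right_comm |k₂ + k₃|]
        gcongr
    -- If `M ≤ 4|k₂|`, then `⟨k₂⟩` is the dominant factor. Otherwise `|k₂| ≤ M/4 ≤ |k₁|/2`, so
    -- `4|k₁+k₂| ≥ M` and `|k₁+k₂|` dominates.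
    have i2 : 1 ≤ 8 * (|k₁ + k₂| * |k₂ + k₃| * bracket k₂ * w) := by
      have p2 := bracket_pos k₂
      rcases le_total M (4 * |k₂|) with h | h
      · have := (one_le_mul_rpow_neg ha0 hb0 hB2 (C := 8) (by norm_num) (by linarith)
          (by linarith) hδ hδ').trans (mul_le_mul_of_nonneg_left
            (mul_le_mul_of_nonneg_left w₄ (by positivity)) (by norm_num))
        exact this
      · have h1 : |k₁| ≤ |k₁ + k₂| + |k₂| := by
          have := abs_sub (k₁ + k₂) k₂
          rwa [add_sub_cancel_right] at this
        have := (one_le_mul_rpow_neg hb0 p2 (z := 4 * |k₁ + k₂|) (by linarith) one_le_two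
          (by linarith) (by linarith) hδ hδ').trans (mul_le_mul_of_nonneg_left
            (mul_le_mul_of_nonneg_left w₂ (by positivity)) (by norm_num))
        linarith
    -- Split `|k| ≤ |k₁+k₂| + |k₃|`; the first part uses `i1`, the second `i2`, whence `10 = 2 + 8`.
    have i3 : |k| ≤ 10 * (|k₁ + k₂| * |k₂ + k₃| * bracket k₂ * bracket k₃ * w) := by
      have h1 : |k| ≤ |k₁ + k₂| + |k₃| := abs_add_le _ _
      have h2 := mul_le_mul_of_nonneg_left i1 ha0.le
      have h3 := mul_le_mul_of_nonneg_left i2 (bracket_pos k₃).le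
      linarith
    set Q := |k₁ + k₂| * |k₂ + k₃| * bracket k₂ * bracket k₃ * w
    have hQ : 0 ≤ Q := by
      have p2 := bracket_pos k₂
      have p3 := bracket_pos k₃
      positivity
    have h0 := abs_nonneg k
    have hM0 : 0 ≤ M := by linarith
    calc k ^ 2 * bracket k = |k| * |k| * (1 + |k|) := by rw [hsq, hkk]
      _ ≤ 10 * Q * (3 / 2 * M) * (5 / 2 * M) := by
          gcongr
          · linarith
          · linarith
      _ = 75 * ((M * Q) * (1 / 2 * M)) := by ring
      _ ≤ 1000 * ((M * Q) * bracket k₁) := by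
          have : 1 / 2 * M ≤ bracket k₁ := by linarith
          have h5 := mul_le_mul_of_nonneg_left this (mul_nonneg hM0 hQ)
          have h6 : 0 ≤ M * Q * bracket k₁ := mul_nonneg (mul_nonneg hM0 hQ) (bracket_pos k₁).le
          linarith
      _ = 1000 * (|k₁ + k₂| * |k₂ + k₃| * M * (bracket k₁ * bracket k₂ * bracket k₃) * w) := by
          simp only [Q]; ring
      _ ≤ _ := by
          have p1 := bracket_pos k₁
          have p2 := bracket_pos k₂
          have p3 := bracket_pos k₃
          gcongr
          rw [abs_mul, abs_mul]
          exact le_add_of_nonneg_left zero_le_one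

/-- Everything is symmetric in the three frequencies, so two transpositions reduce to the ordering
assumed in `multiplier_le_of_max`. -/
theorem multiplier_le {k₁ k₂ k₃ δ : ℝ} (hδ : 0 ≤ δ) (hδ' : δ ≤ 1 / 2)
    (ha : k₁ + k₂ ≠ 0) (hb : k₂ + k₃ ≠ 0) (hc : k₃ + k₁ ≠ 0) :
    (k₁ + k₂ + k₃) ^ 2 * bracket (k₁ + k₂ + k₃) ≤
      1000 * ((1 + |(k₁ + k₂) * (k₂ + k₃) * (k₃ + k₁)|) *
        (bracket k₁ * bracket k₂ * bracket k₃) * freqWeight (1 + δ) k₁ k₂ k₃) := by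
  let P : ℝ → ℝ → ℝ → Prop := fun k₁ k₂ k₃ => (k₁ + k₂ + k₃) ^ 2 * bracket (k₁ + k₂ + k₃) ≤
      1000 * ((1 + |(k₁ + k₂) * (k₂ + k₃) * (k₃ + k₁)|) *
        (bracket k₁ * bracket k₂ * bracket k₃) * freqWeight (1 + δ) k₁ k₂ k₃)
  have swap_left : ∀ x y z, P x y z → P y x z := fun x y z h => by
    simp only [P] at h ⊢
    rw [freqWeight_swap_left, show y + x + z = x + y + z by ring,
      show (y + x) * (x + z) * (z + y) = (x + y) * (y + z) * (z + x) by ring,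
      mul_comm (bracket y)]
    exact h
  have swap_outer : ∀ x y z, P x y z → P z y x := fun x y z h => by
    simp only [P] at h ⊢
    rw [freqWeight_swap_outer, show z + y + x = x + y + z by ring,
      show (z + y) * (y + x) * (x + z) = (x + y) * (y + z) * (z + x) by ring,
      show bracket z * bracket y * bracket x = bracket x * bracket y * bracket z by ring]
    exact h
  have max_case : ∀ x y z, x + y ≠ 0 → y + z ≠ 0 → |x + y| ≤ |z + x| → |y + z| ≤ |z + x| →
      P x y z := by
    intro x y z hxy hyz h1 h2
    rcases le_total |z| |x| with h | h
    · exact multiplier_le_of_max hδ hδ' hxy hyz h1 h2 h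
    · refine swap_outer _ _ _ (multiplier_le_of_max hδ hδ' ?_ ?_ ?_ ?_ h)
      · rwa [add_comm]
      · rwa [add_comm]
      · rwa [add_comm z y, add_comm x z]
      · rwa [add_comm y x, add_comm x z]
  have case_c : |k₁ + k₂| ≤ |k₃ + k₁| → |k₂ + k₃| ≤ |k₃ + k₁| → P k₁ k₂ k₃ :=
    max_case _ _ _ ha hb
  have case_b : |k₁ + k₂| ≤ |k₂ + k₃| → |k₃ + k₁| ≤ |k₂ + k₃| → P k₁ k₂ k₃ := fun h1 h2 => by
    refine swap_left _ _ _ (max_case k₂ k₁ k₃ (by rwa [add_comm]) (by rwa [add_comm]) ?_ ?_)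
    · rwa [add_comm k₂ k₁, add_comm k₃ k₂]
    · rwa [add_comm k₁ k₃, add_comm k₃ k₂]
  have case_a : |k₂ + k₃| ≤ |k₁ + k₂| → |k₃ + k₁| ≤ |k₁ + k₂| → P k₁ k₂ k₃ := fun h1 h2 => by
    refine swap_outer _ _ _ (swap_left _ _ _ (max_case k₂ k₃ k₁ hb hc h1 h2))
  rcases le_total |k₁ + k₂| |k₂ + k₃| with h1 | h1
  · rcases le_total |k₂ + k₃| |k₃ + k₁| with h2 | h2
    · exact case_c (h1.trans h2) h2
    · exact case_b h1 h2
  · rcases le_total |k₁ + k₂| |k₃ + k₁| with h2 | h2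
    · exact case_c h2 (h1.trans h2)
    · exact case_a h1 h2

theorem bracket_add_le (x y : ℝ) : bracket (x + y) ≤ bracket x * bracket y := by
  unfold bracket
  have := abs_add_le x y
  nlinarith [abs_nonneg x, abs_nonneg y, mul_nonneg (abs_nonneg x) (abs_nonneg y)]

/-- The characteristic surface `τ = 4π²k³`. -/
def disp (k : ℝ) : ℝ := 4 * Real.pi ^ 2 * k ^ 3

/-- Rests on `(a+b+c)³ - a³ - b³ - c³ = 3(a+b)(b+c)(c+a)`. -/
theorem one_add_resonance_le (k₁ k₂ k₃ : ℝ) :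
    1 + |(k₁ + k₂) * (k₂ + k₃) * (k₃ + k₁)| ≤
      bracket (disp (k₁ + k₂ + k₃) - disp k₁ - disp k₂ - disp k₃) := by
  have e : disp (k₁ + k₂ + k₃) - disp k₁ - disp k₂ - disp k₃ =
      12 * Real.pi ^ 2 * ((k₁ + k₂) * (k₂ + k₃) * (k₃ + k₁)) := by unfold disp; ring
  have hpi : (1 : ℝ) ≤ 12 * Real.pi ^ 2 := by nlinarith [Real.pi_gt_three]
  rw [e, bracket, abs_mul (12 * Real.pi ^ 2), abs_of_pos (by positivity : 0 < 12 * Real.pi ^ 2)]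
  nlinarith [abs_nonneg ((k₁ + k₂) * (k₂ + k₃) * (k₃ + k₁))]

/-- The multiplier estimate behind the trilinear estimate at regularity `s ≥ 1/2`. -/
theorem multiplier_rpow_le {k₁ k₂ k₃ δ s : ℝ} (hs : 1 / 2 ≤ s) (hδ : 0 ≤ δ) (hδ' : δ ≤ 1 / 2)
    (ha : k₁ + k₂ ≠ 0) (hb : k₂ + k₃ ≠ 0) (hc : k₃ + k₁ ≠ 0) :
    (k₁ + k₂ + k₃) ^ 2 * bracket (k₁ + k₂ + k₃) ^ (2 * s) ≤
      1000 * (bracket (disp (k₁ + k₂ + k₃) - disp k₁ - disp k₂ - disp k₃) *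
        (bracket k₁ ^ (2 * s) * bracket k₂ ^ (2 * s) * bracket k₃ ^ (2 * s)) *
          freqWeight (1 + δ) k₁ k₂ k₃) := by
  have p1 := bracket_pos k₁
  have p2 := bracket_pos k₂
  have p3 := bracket_pos k₃
  have pk := bracket_pos (k₁ + k₂ + k₃)
  have hw := freqWeight_pos (1 + δ) k₁ k₂ k₃
  have hB : bracket (k₁ + k₂ + k₃) ≤ bracket k₁ * bracket k₂ * bracket k₃ :=
    (bracket_add_le _ _).trans (by gcongr; exact bracket_add_le _ _)
  -- Reduction to `s = 1/2`: the surplus power `2s - 1 ≥ 0` is distributed by submultiplicativity of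
  -- the bracket.
  have hsplit : ∀ x : ℝ, 0 < x → x ^ (2 * s) = x * x ^ (2 * s - 1) := fun x hx => by
    nth_rw 2 [← Real.rpow_one x]
    rw [← Real.rpow_add hx]
    ring_nf
  have hpow : bracket (k₁ + k₂ + k₃) ^ (2 * s - 1) ≤
      bracket k₁ ^ (2 * s - 1) * bracket k₂ ^ (2 * s - 1) * bracket k₃ ^ (2 * s - 1) := by
    rw [← Real.mul_rpow p1.le p2.le, ← Real.mul_rpow (by positivity) p3.le]
    exact Real.rpow_le_rpow pk.le hB (by linarith)
  have hm := (multiplier_le hδ hδ' ha hb hc).trans (mul_le_mul_of_nonneg_left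
    (mul_le_mul_of_nonneg_right (mul_le_mul_of_nonneg_right (one_add_resonance_le k₁ k₂ k₃)
      (by positivity)) hw.le) (by norm_num))
  have pD := bracket_pos (disp (k₁ + k₂ + k₃) - disp k₁ - disp k₂ - disp k₃)
  rw [hsplit _ pk, hsplit _ p1, hsplit _ p2, hsplit _ p3, ← mul_assoc]
  refine (mul_le_mul hm hpow (by positivity) (by positivity)).trans (le_of_eq ?_)
  ring

/-! ### Sums over the lattice of frequencies -/

/-- A common bound for the weights `⟨n / L⟩^{-p}` and `|n / L|^{-p}`. -/
def latWeight (p L : ℝ) (n : ℤ) : ℝ≥0∞ :=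
  ENNReal.ofReal (L ^ p * (|(n : ℝ)| ^ (-p) + if n = 0 then 1 else 0))

theorem tsum_latWeight {p : ℝ} (hp : 1 < p) :
    ∃ C : ℝ, 0 < C ∧ ∀ L : ℝ, 1 ≤ L → ∑' n, latWeight p L n = ENNReal.ofReal (C * L ^ p) := by
  have h1 : Summable fun n : ℤ => |(n : ℝ)| ^ (-p) := Real.summable_abs_int_rpow hp
  have h2 : Summable fun n : ℤ => if n = 0 then (1 : ℝ) else 0 :=
    (hasSum_ite_eq (0 : ℤ) (1 : ℝ)).summable
  refine ⟨(∑' n : ℤ, |(n : ℝ)| ^ (-p)) + 1,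
    add_pos_of_nonneg_of_pos (tsum_nonneg fun n => by positivity) one_pos, fun L hL => ?_⟩
  have hLp : 0 ≤ L ^ p := by positivity
  unfold latWeight
  rw [← ENNReal.ofReal_tsum_of_nonneg (fun n => ?_) ((h1.add h2).mul_left _), tsum_mul_left,
    h1.tsum_add h2, tsum_ite_eq, mul_comm]
  split_ifs <;> positivity

theorem ofReal_abs_rpow_le {p L : ℝ} (hL : 1 ≤ L) (n : ℤ) :
    ENNReal.ofReal (|(n : ℝ) / L| ^ (-p)) ≤ latWeight p L n := by
  have hL0 : 0 < L := by linarith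
  refine ENNReal.ofReal_le_ofReal ?_
  have e : |(n : ℝ) / L| ^ (-p) = L ^ p * |(n : ℝ)| ^ (-p) := by
    rw [abs_div, abs_of_pos hL0, Real.div_rpow (abs_nonneg _) hL0.le, Real.rpow_neg hL0.le,
      div_inv_eq_mul, mul_comm]
  rw [e]
  gcongr
  refine le_add_of_nonneg_right ?_
  split_ifs <;> norm_num

theorem ofReal_bracket_rpow_le {p L : ℝ} (hp : 0 ≤ p) (hL : 1 ≤ L) (n : ℤ) :
    ENNReal.ofReal (bracket ((n : ℝ) / L) ^ (-p)) ≤ latWeight p L n := by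
  -- At zero the power `|n|^(-p)` gives no useful bound, and the extra unit in `latWeight` takes
  -- over.
  by_cases hn : n = 0
  · refine ENNReal.ofReal_le_ofReal ?_
    have h1 : bracket ((n : ℝ) / L) ^ (-p) = 1 := by simp [hn, bracket]
    have h2 : 1 ≤ L ^ p := Real.one_le_rpow hL hp
    rw [h1, if_pos hn]
    have h3 : 0 ≤ |(n : ℝ)| ^ (-p) := by positivity
    nlinarith
  · refine le_trans (ENNReal.ofReal_le_ofReal ?_) (ofReal_abs_rpow_le hL n)
    have h0 : 0 < |(n : ℝ) / L| := by
      rw [abs_pos]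
      exact div_ne_zero (Int.cast_ne_zero.2 hn) (by linarith)
    exact Real.rpow_le_rpow_of_nonpos h0 (by unfold bracket; linarith) (by linarith)

/-- Two linear forms that determine the triple together with its sum make the map injective, so the
sum is dominated by the full double sum. A pair such as `k₁+k₂`, `k₃` would fail, which is why
`freqWeight` contains none. -/
theorem tsum_nonresonant_le (E : ℤ → ℝ≥0∞) (n : ℤ) (l : ℤ × ℤ × ℤ → ℤ × ℤ)
    (hl : ∀ q q' : ℤ × ℤ × ℤ, q.1 + q.2.1 + q.2.2 = q'.1 + q'.2.1 + q'.2.2 →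
      l q = l q' → q = q') :
    ∑' q : nonresonant n, E (l q).1 * E (l q).2 ≤ (∑' m, E m) ^ 2 := by
  have hinj : Function.Injective fun q : nonresonant n => l q := fun q q' h =>
    Subtype.ext (hl q q' (q.2.1.trans q'.2.1.symm) h)
  refine (ENNReal.tsum_comp_le_tsum_of_injective hinj fun z : ℤ × ℤ => E z.1 * E z.2).trans
    (le_of_eq ?_)
  rw [ENNReal.tsum_prod (f := fun i j => E i * E j), sq]
  simp only [ENNReal.tsum_mul_left, ENNReal.tsum_mul_right]

theorem tsum_freqWeight_le {p : ℝ} (hp : 1 < p) :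
    ∃ C : ℝ, 0 < C ∧ ∀ L : ℝ, 1 ≤ L → ∀ n : ℤ,
      ∑' q : nonresonant n, ENNReal.ofReal (freqWeight p ((q : ℤ × ℤ × ℤ).1 / L)
        ((q : ℤ × ℤ × ℤ).2.1 / L) ((q : ℤ × ℤ × ℤ).2.2 / L)) ≤
        ENNReal.ofReal (C * L ^ (2 * p)) := by
  obtain ⟨C, hC, hsum⟩ := tsum_latWeight hp
  refine ⟨12 * C ^ 2, by positivity, fun L hL n => ?_⟩
  set E := latWeight p L
  set S := ∑' m, E m
  have hp0 : 0 ≤ p := by linarith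
  have U : ∀ m : ℤ, ENNReal.ofReal (bracket ((m : ℝ) / L) ^ (-p)) ≤ E m := fun m =>
    ofReal_bracket_rpow_le hp0 hL m
  have V : ∀ i j : ℤ, ENNReal.ofReal (|(i : ℝ) / L + (j : ℝ) / L| ^ (-p)) ≤ E (i + j) :=
    fun i j => by
      rw [← add_div, ← Int.cast_add]
      exact ofReal_abs_rpow_le hL (i + j)
  have hpt : ∀ q : ℤ × ℤ × ℤ, ENNReal.ofReal (freqWeight p (q.1 / L) (q.2.1 / L) (q.2.2 / L)) ≤
      (E q.1 * E q.2.1 + E q.2.1 * E q.2.2 + E q.1 * E q.2.2) +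
      (E (q.1 + q.2.1) * E (q.2.1 + q.2.2) + E (q.2.1 + q.2.2) * E (q.2.2 + q.1) +
        E (q.1 + q.2.1) * E (q.2.2 + q.1)) +
      (E (q.1 + q.2.1) * E q.1 + E (q.1 + q.2.1) * E q.2.1) +
      (E (q.2.1 + q.2.2) * E q.2.1 + E (q.2.1 + q.2.2) * E q.2.2) +
      (E (q.2.2 + q.1) * E q.1 + E (q.2.2 + q.1) * E q.2.2) := by
    intro q
    have hadd : ∀ {x y : ℝ} {X Y : ℝ≥0∞}, ENNReal.ofReal x ≤ X → ENNReal.ofReal y ≤ Y →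
        ENNReal.ofReal (x + y) ≤ X + Y := fun hx hy =>
      ENNReal.ofReal_add_le.trans (add_le_add hx hy)
    have hmul : ∀ {x y : ℝ} {X Y : ℝ≥0∞}, 0 ≤ x → ENNReal.ofReal x ≤ X → ENNReal.ofReal y ≤ Y →
        ENNReal.ofReal (x * y) ≤ X * Y := fun h0 hx hy => by
      rw [ENNReal.ofReal_mul h0]
      exact mul_le_mul' hx hy
    have pU : ∀ x : ℝ, 0 ≤ bracket x ^ (-p) := fun x => Real.rpow_nonneg (bracket_pos x).le _
    have pV : ∀ x : ℝ, 0 ≤ |x| ^ (-p) := fun x => Real.rpow_nonneg (abs_nonneg x) _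
    unfold freqWeight
    exact hadd (hadd (hadd (hadd
      (hadd (hadd (hmul (pU _) (U _) (U _)) (hmul (pU _) (U _) (U _)))
        (hmul (pU _) (U _) (U _)))
      (hadd (hadd (hmul (pV _) (V _ _) (V _ _)) (hmul (pV _) (V _ _) (V _ _)))
        (hmul (pV _) (V _ _) (V _ _))))
      (hadd (hmul (pV _) (V _ _) (U _)) (hmul (pV _) (V _ _) (U _))))
      (hadd (hmul (pV _) (V _ _) (U _)) (hmul (pV _) (V _ _) (U _))))
      (hadd (hmul (pV _) (V _ _) (U _)) (hmul (pV _) (V _ _) (U _)))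
  refine (ENNReal.tsum_le_tsum fun q : nonresonant n => hpt q).trans ?_
  simp only [ENNReal.tsum_add]
  have T : ∀ l : ℤ × ℤ × ℤ → ℤ × ℤ, (∀ q q' : ℤ × ℤ × ℤ,
      q.1 + q.2.1 + q.2.2 = q'.1 + q'.2.1 + q'.2.2 → l q = l q' → q = q') →
      ∑' q : nonresonant n, E (l q).1 * E (l q).2 ≤ S ^ 2 := tsum_nonresonant_le E n
  have e : ENNReal.ofReal (12 * C ^ 2 * L ^ (2 * p)) =
      (S ^ 2 + S ^ 2 + S ^ 2) + (S ^ 2 + S ^ 2 + S ^ 2) + (S ^ 2 + S ^ 2) + (S ^ 2 + S ^ 2) +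
        (S ^ 2 + S ^ 2) := by
    have hS : S = ENNReal.ofReal (C * L ^ p) := hsum L hL
    have hL2 : L ^ (2 * p) = (L ^ p) ^ 2 := by
      rw [mul_comm, Real.rpow_mul (by linarith)]
      norm_num
    rw [hL2, mul_assoc, ENNReal.ofReal_mul (by norm_num), ← mul_pow,
      ENNReal.ofReal_pow (by positivity), ← hS]
    norm_num
    ring
  rw [e]
  have inj : ∀ q q' : ℤ × ℤ × ℤ, q.1 = q'.1 ∧ q.2.1 = q'.2.1 ∧ q.2.2 = q'.2.2 → q = q' :=
    fun q q' h => Prod.ext h.1 (Prod.ext h.2.1 h.2.2)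
  refine add_le_add (add_le_add (add_le_add (add_le_add
    (add_le_add (add_le_add (T (fun q => (q.1, q.2.1)) ?_) (T (fun q => (q.2.1, q.2.2)) ?_))
      (T (fun q => (q.1, q.2.2)) ?_))
    (add_le_add (add_le_add (T (fun q => (q.1 + q.2.1, q.2.1 + q.2.2)) ?_)
      (T (fun q => (q.2.1 + q.2.2, q.2.2 + q.1)) ?_))
      (T (fun q => (q.1 + q.2.1, q.2.2 + q.1)) ?_)))
    (add_le_add (T (fun q => (q.1 + q.2.1, q.1)) ?_) (T (fun q => (q.1 + q.2.1, q.2.1)) ?_)))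
    (add_le_add (T (fun q => (q.2.1 + q.2.2, q.2.1)) ?_)
      (T (fun q => (q.2.1 + q.2.2, q.2.2)) ?_)))
    (add_le_add (T (fun q => (q.2.2 + q.1, q.1)) ?_) (T (fun q => (q.2.2 + q.1, q.2.2)) ?_))
  all_goals
    intro q q' h1 h2
    simp only [Prod.mk.injEq] at h2
    exact inj q q' (by omega)

/-- The lattice analogue of `lintegral_triple_wt_le`. Only finiteness matters, since it serves
convergence and not the final bound. -/
theorem tsum_inv_bracket_lt_top {L : ℝ} (hL : 1 ≤ L) (n : ℤ) :
    ∑' q : nonresonant n, (wt 0 ((q : ℤ × ℤ × ℤ).1 / L))⁻¹ * (wt 0 ((q : ℤ × ℤ × ℤ).2.1 / L))⁻¹ *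
      (wt 0 ((q : ℤ × ℤ × ℤ).2.2 / L))⁻¹ < ∞ := by
  obtain ⟨C, hC, hsum⟩ := tsum_latWeight (p := 3 / 2) (by norm_num)
  set E := latWeight (3 / 2) L
  have hS : ∑' m, E m < ∞ := by rw [hsum L hL]; exact ENNReal.ofReal_lt_top
  have U : ∀ m : ℤ, wt 0 ((m : ℝ) / L) ^ (-(3 / 2) : ℝ) ≤ E m := fun m => by
    rw [wt, sub_zero, ENNReal.ofReal_rpow_of_pos (bracket_pos _)]
    exact ofReal_bracket_rpow_le (by norm_num) hL m
  have hpt : ∀ q : ℤ × ℤ × ℤ, (wt 0 (q.1 / L))⁻¹ * (wt 0 (q.2.1 / L))⁻¹ * (wt 0 (q.2.2 / L))⁻¹ ≤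
      E q.1 * E q.2.1 + E q.2.1 * E q.2.2 + E q.1 * E q.2.2 := fun q =>
    (inv_mul_inv_mul_inv_le (one_le_wt _ _) (wt_ne_top _ _) (one_le_wt _ _) (wt_ne_top _ _)
      (one_le_wt _ _) (wt_ne_top _ _)).trans (by gcongr <;> exact U _)
  refine (ENNReal.tsum_le_tsum fun q : nonresonant n => hpt q).trans_lt ?_
  simp only [ENNReal.tsum_add]
  have inj : ∀ q q' : ℤ × ℤ × ℤ, q.1 = q'.1 ∧ q.2.1 = q'.2.1 ∧ q.2.2 = q'.2.2 → q = q' :=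
    fun q q' h => Prod.ext h.1 (Prod.ext h.2.1 h.2.2)
  have hS2 : (∑' m, E m) ^ 2 < ∞ := ENNReal.pow_lt_top hS
  refine ENNReal.add_lt_top.2 ⟨ENNReal.add_lt_top.2
    ⟨(tsum_nonresonant_le E n (fun q => (q.1, q.2.1)) ?_).trans_lt hS2,
    (tsum_nonresonant_le E n (fun q => (q.2.1, q.2.2)) ?_).trans_lt hS2⟩,
    (tsum_nonresonant_le E n (fun q => (q.1, q.2.2)) ?_).trans_lt hS2⟩
  all_goals
    intro q q' h1 h2
    simp only [Prod.mk.injEq] at h2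
    exact inj q q' (by omega)

/-- Summing over all triples with a given sum, and then over all sums, is at most summing over all
triples. -/
theorem tsum_tsum_nonresonant_le (a b c : ℤ → ℝ≥0∞) :
    ∑' n, ∑' q : nonresonant n, a (q : ℤ × ℤ × ℤ).1 * b (q : ℤ × ℤ × ℤ).2.1 *
      c (q : ℤ × ℤ × ℤ).2.2 ≤ (∑' n, a n) * (∑' n, b n) * ∑' n, c n := by
  rw [← ENNReal.tsum_sigma' (f := fun z : (n : ℤ) × nonresonant n =>
    a (z.2 : ℤ × ℤ × ℤ).1 * b (z.2 : ℤ × ℤ × ℤ).2.1 * c (z.2 : ℤ × ℤ × ℤ).2.2)]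
  have hinj : Function.Injective fun z : (n : ℤ) × nonresonant n => (z.2 : ℤ × ℤ × ℤ) := by
    rintro ⟨n, q, hq⟩ ⟨n', q', hq'⟩ h
    simp only at h
    subst h
    obtain rfl : n = n' := hq.1.symm.trans hq'.1
    rfl
  refine (ENNReal.tsum_comp_le_tsum_of_injective hinj
    fun q : ℤ × ℤ × ℤ => a q.1 * b q.2.1 * c q.2.2).trans (le_of_eq ?_)
  rw [ENNReal.tsum_prod (f := fun i (z : ℤ × ℤ) => a i * b z.1 * c z.2)]
  have h : ∀ i, ∑' z : ℤ × ℤ, a i * b z.1 * c z.2 = a i * ((∑' n, b n) * ∑' n, c n) := fun i => by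
    rw [ENNReal.tsum_prod (f := fun j k => a i * b j * c k)]
    simp only [ENNReal.tsum_mul_left, ENNReal.tsum_mul_right]
    ring
  simp only [h, ENNReal.tsum_mul_right]
  ring

/-! ### The trilinear estimate -/

/-- The contribution of the frequency `n / L` to the square of the `X^{s,1/2}` norm. -/
def energy (L s : ℝ) (g : ℤ → ℝ → ℂ) (n : ℤ) : ℝ≥0∞ :=
  ENNReal.ofReal (bracket ((n : ℝ) / L) ^ (2 * s)) *
    ∫⁻ τ, wt (disp ((n : ℝ) / L)) τ * ‖g n τ‖ₑ ^ 2

/-- The contribution of the frequency `n / L` to the square of the `X^{s,-1/2}` norm. -/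
def dualEnergy (L s : ℝ) (g : ℤ → ℝ → ℂ) (n : ℤ) : ℝ≥0∞ :=
  ENNReal.ofReal (bracket ((n : ℝ) / L) ^ (2 * s)) *
    ∫⁻ τ, (wt (disp ((n : ℝ) / L)) τ)⁻¹ * ‖g n τ‖ₑ ^ 2

theorem bracket_rpow_sq (x s : ℝ) : (bracket x ^ s) ^ 2 = bracket x ^ (2 * s) := by
  rw [mul_comm, Real.rpow_mul (bracket_pos x).le]
  norm_num

theorem weightedNorm_half (L s : ℝ) (g : ℤ → ℝ → ℂ) :
    weightedNorm L s (1 / 2) g =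
      (ENNReal.ofReal (1 / L) * ∑' n, energy L s g n) ^ (1 / 2 : ℝ) := by
  unfold weightedNorm energy
  congr 3
  ext n
  rw [← lintegral_const_mul' _ _ ENNReal.ofReal_ne_top]
  refine lintegral_congr fun τ => ?_
  rw [mul_pow, ← ENNReal.ofReal_pow (by
    have := bracket_pos ((n : ℝ) / L)
    have := bracket_pos (τ - 4 * Real.pi ^ 2 * ((n : ℝ) / L) ^ 3)
    positivity), mul_pow, bracket_rpow_sq, bracket_rpow_sq,
    ENNReal.ofReal_mul (Real.rpow_nonneg (bracket_pos _).le _), mul_assoc, wt, disp]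
  norm_num

theorem weightedNorm_neg_half (L s : ℝ) (g : ℤ → ℝ → ℂ) :
    weightedNorm L s (-(1 / 2)) g =
      (ENNReal.ofReal (1 / L) * ∑' n, dualEnergy L s g n) ^ (1 / 2 : ℝ) := by
  unfold weightedNorm dualEnergy
  congr 3
  ext n
  rw [← lintegral_const_mul' _ _ ENNReal.ofReal_ne_top]
  refine lintegral_congr fun τ => ?_
  rw [mul_pow, ← ENNReal.ofReal_pow (by
    have := bracket_pos ((n : ℝ) / L)
    have := bracket_pos (τ - 4 * Real.pi ^ 2 * ((n : ℝ) / L) ^ 3)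
    positivity), mul_pow, bracket_rpow_sq, bracket_rpow_sq,
    ENNReal.ofReal_mul (Real.rpow_nonneg (bracket_pos _).le _), mul_assoc, wt, disp,
    ← ENNReal.ofReal_inv_of_pos (bracket_pos _), ← Real.rpow_neg_one]
  norm_num

/-- Cauchy–Schwarz over the index with free weights `ω`. It is used with inverse brackets for
convergence and with `freqWeight` for the estimate. -/
theorem lintegral_tsum_sq_le {ι : Type*} [Countable ι] {x : ι → ℝ → ℝ≥0∞}
    (hx : ∀ i, AEMeasurable (x i) volume) {W : ℝ → ℝ≥0∞} (hW : Measurable W) {ω : ι → ℝ≥0∞}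
    (h0 : ∀ i, ω i ≠ 0) (h1 : ∀ i, ω i ≠ ∞) :
    ∫⁻ t, W t * (∑' i, x i t) ^ 2 ≤ (∑' i, ω i) * ∑' i, (ω i)⁻¹ * ∫⁻ t, W t * x i t ^ 2 := by
  have hpt : ∀ t, W t * (∑' i, x i t) ^ 2 ≤
      ∑' i, (∑' j, ω j) * ((ω i)⁻¹ * (W t * x i t ^ 2)) := fun t => by
    have h := tsum_sq_le_mul (u := fun i => x i t) (p := ω) (q := fun i => (ω i)⁻¹ * x i t ^ 2)
      fun i => by rw [← mul_assoc, ENNReal.mul_inv_cancel (h0 i) (h1 i), one_mul]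
    refine (mul_le_mul_right h (W t)).trans (le_of_eq ?_)
    rw [ENNReal.tsum_mul_left, mul_left_comm, ← ENNReal.tsum_mul_left]
    congr 2
    ext i
    ring
  refine (lintegral_mono hpt).trans (le_of_eq ?_)
  have hm : ∀ i, AEMeasurable (fun t => W t * x i t ^ 2) volume := fun i =>
    hW.aemeasurable.mul ((hx i).pow_const 2)
  rw [lintegral_tsum fun i => ((hm i).const_mul _).const_mul _, ← ENNReal.tsum_mul_left]
  congr 1
  ext i
  rw [lintegral_const_mul'' _ ((hm i).const_mul _), lintegral_const_mul'' _ (hm i)]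

section

variable {L s : ℝ} {g₁ g₂ g₃ : ℤ → ℝ → ℂ}

theorem lintegral_lt_top_of_energy {g : ℤ → ℝ → ℂ} (h : ∑' n, energy L s g n < ∞) (n : ℤ) :
    ∫⁻ τ, wt (disp ((n : ℝ) / L)) τ * ‖g n τ‖ₑ ^ 2 < ∞ := by
  have h1 : energy L s g n < ∞ := (ENNReal.le_tsum n).trans_lt h
  refine ENNReal.lt_top_of_mul_ne_top_right h1.ne ?_
  simpa using Real.rpow_pos_of_pos (bracket_pos _) _

theorem lintegral_le_energy (hs : 1 / 2 ≤ s) (g : ℤ → ℝ → ℂ) (n : ℤ) :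
    wt 0 ((n : ℝ) / L) * ∫⁻ τ, wt (disp ((n : ℝ) / L)) τ * ‖g n τ‖ₑ ^ 2 ≤ energy L s g n := by
  unfold energy
  gcongr
  rw [wt, sub_zero]
  refine ENNReal.ofReal_le_ofReal ?_
  conv_lhs => rw [← Real.rpow_one (bracket ((n : ℝ) / L))]
  exact Real.rpow_le_rpow_of_exponent_le (one_le_bracket _) (by linarith)

/-- The nonresonant interactions of three fixed frequencies. -/
theorem nonresonant_energy_le (hs : 1 / 2 ≤ s) {δ : ℝ} (hδ : 0 ≤ δ) (hδ' : δ ≤ 1 / 2) (hL : 1 ≤ L)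
    (m₁ : ∀ n, Measurable (g₁ n)) (m₂ : ∀ n, Measurable (g₂ n)) (m₃ : ∀ n, Measurable (g₃ n))
    {n : ℤ} (q : nonresonant n) {T : ℝ → ℂ}
    (hT : ∀ x, ‖T x‖ₑ ≤ conv3 (fun y => ‖g₁ (q : ℤ × ℤ × ℤ).1 y‖ₑ)
      (fun y => ‖g₂ (q : ℤ × ℤ × ℤ).2.1 y‖ₑ) (fun y => ‖g₃ (q : ℤ × ℤ × ℤ).2.2 y‖ₑ) x) :
    ENNReal.ofReal (((n : ℝ) / L) ^ 2 * bracket ((n : ℝ) / L) ^ (2 * s)) *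
      ((ENNReal.ofReal (freqWeight (1 + δ) ((q : ℤ × ℤ × ℤ).1 / L) ((q : ℤ × ℤ × ℤ).2.1 / L)
        ((q : ℤ × ℤ × ℤ).2.2 / L)))⁻¹ *
        ∫⁻ x, (wt (disp ((n : ℝ) / L)) x)⁻¹ * ‖T x‖ₑ ^ 2) ≤
      48000 * kap ^ 2 * (energy L s g₁ (q : ℤ × ℤ × ℤ).1 * energy L s g₂ (q : ℤ × ℤ × ℤ).2.1 *
        energy L s g₃ (q : ℤ × ℤ × ℤ).2.2) := by
  obtain ⟨⟨n₁, n₂, n₃⟩, hn, hr⟩ := q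
  simp only at hn hr hT ⊢
  have hL0 : L ≠ 0 := by linarith
  obtain ⟨⟨ha, hb⟩, hc⟩ : ((n₁ + n₂ ≠ 0) ∧ (n₂ + n₃ ≠ 0)) ∧ n₃ + n₁ ≠ 0 := by
    simpa only [mul_ne_zero_iff] using hr
  have hne : ∀ i j : ℤ, i + j ≠ 0 → (i : ℝ) / L + (j : ℝ) / L ≠ 0 := fun i j h => by
    rw [← add_div]
    exact div_ne_zero (by exact_mod_cast h) hL0
  have hk : (n : ℝ) / L = (n₁ : ℝ) / L + (n₂ : ℝ) / L + (n₃ : ℝ) / L := by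
    rw [← add_div, ← add_div, ← hn]
    push_cast
    ring
  have hmult := multiplier_rpow_le hs hδ hδ' (hne _ _ ha) (hne _ _ hb) (hne _ _ hc)
  rw [← hk] at hmult
  have hw := freqWeight_pos (1 + δ) ((n₁ : ℝ) / L) ((n₂ : ℝ) / L) ((n₃ : ℝ) / L)
  set w := freqWeight (1 + δ) ((n₁ : ℝ) / L) ((n₂ : ℝ) / L) ((n₃ : ℝ) / L)
  set D := bracket (disp ((n : ℝ) / L) - disp ((n₁ : ℝ) / L) - disp ((n₂ : ℝ) / L) -
    disp ((n₃ : ℝ) / L))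
  set b₁ := bracket ((n₁ : ℝ) / L) ^ (2 * s) with hb₁
  set b₂ := bracket ((n₂ : ℝ) / L) ^ (2 * s) with hb₂
  set b₃ := bracket ((n₃ : ℝ) / L) ^ (2 * s) with hb₃
  have p₁ : 0 ≤ b₁ := Real.rpow_nonneg (bracket_pos _).le _
  have p₂ : 0 ≤ b₂ := Real.rpow_nonneg (bracket_pos _).le _
  have p₃ : 0 ≤ b₃ := Real.rpow_nonneg (bracket_pos _).le _
  have pD : 0 ≤ D := (bracket_pos _).le
  set I := ∫⁻ x, (wt (disp ((n : ℝ) / L)) x)⁻¹ * ‖T x‖ₑ ^ 2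
  have hI := lintegral_modulation_le (m₁ n₁).enorm (m₂ n₂).enorm (m₃ n₃).enorm
    (disp ((n : ℝ) / L)) (disp ((n₁ : ℝ) / L)) (disp ((n₂ : ℝ) / L)) (disp ((n₃ : ℝ) / L))
  have hI' : I ≤ ∫⁻ x, (wt (disp ((n : ℝ) / L)) x)⁻¹ * conv3 (fun y => ‖g₁ n₁ y‖ₑ)
      (fun y => ‖g₂ n₂ y‖ₑ) (fun y => ‖g₃ n₃ y‖ₑ) x ^ 2 := by
    refine lintegral_mono fun x => ?_
    gcongr
    exact hT x
  -- The inverse weight left by Cauchy–Schwarz over triples cancels the weight in the multiplier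
  -- bound.
  have hcancel : ENNReal.ofReal w * (ENNReal.ofReal w)⁻¹ = 1 :=
    ENNReal.mul_inv_cancel (by simpa using hw) ENNReal.ofReal_ne_top
  calc ENNReal.ofReal (((n : ℝ) / L) ^ 2 * bracket ((n : ℝ) / L) ^ (2 * s)) *
        ((ENNReal.ofReal w)⁻¹ * I)
      ≤ ENNReal.ofReal (1000 * (D * (b₁ * b₂ * b₃) * w)) * ((ENNReal.ofReal w)⁻¹ * I) := by
        gcongr
    _ = 1000 * (ENNReal.ofReal b₁ * ENNReal.ofReal b₂ * ENNReal.ofReal b₃) *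
          (ENNReal.ofReal w * (ENNReal.ofReal w)⁻¹) * (ENNReal.ofReal D * I) := by
        rw [ENNReal.ofReal_mul (by norm_num), ENNReal.ofReal_mul (by positivity),
          ENNReal.ofReal_mul pD, ENNReal.ofReal_mul (by positivity), ENNReal.ofReal_mul p₁]
        norm_num
        ring
    _ ≤ 1000 * (ENNReal.ofReal b₁ * ENNReal.ofReal b₂ * ENNReal.ofReal b₃) * 1 *
          (48 * kap ^ 2 * ((∫⁻ y, wt (disp ((n₁ : ℝ) / L)) y * ‖g₁ n₁ y‖ₑ ^ 2) *
            (∫⁻ y, wt (disp ((n₂ : ℝ) / L)) y * ‖g₂ n₂ y‖ₑ ^ 2) *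
            ∫⁻ y, wt (disp ((n₃ : ℝ) / L)) y * ‖g₃ n₃ y‖ₑ ^ 2)) := by
        rw [hcancel]
        exact mul_le_mul_right ((mul_le_mul_right hI' _).trans hI) _
    _ = _ := by
        simp only [energy, hb₁, hb₂, hb₃]
        ring

/-- The resonant interaction `(k, k, -k)`. -/
theorem resonant_energy_le (hs : 1 / 2 ≤ s)
    (m₁ : ∀ n, Measurable (g₁ n)) (m₂ : ∀ n, Measurable (g₂ n)) (m₃ : ∀ n, Measurable (g₃ n))
    {n : ℤ} {T : ℝ → ℂ}
    (hT : ∀ x, ‖T x‖ₑ ≤ conv3 (fun y => ‖g₁ n y‖ₑ) (fun y => ‖g₂ n y‖ₑ)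
      (fun y => ‖g₃ (-n) y‖ₑ) x) :
    ENNReal.ofReal (((n : ℝ) / L) ^ 2 * bracket ((n : ℝ) / L) ^ (2 * s)) *
        ∫⁻ x, (wt (disp ((n : ℝ) / L)) x)⁻¹ * ‖T x‖ₑ ^ 2 ≤
      48 * kap ^ 2 * (energy L s g₁ n * energy L s g₂ n * energy L s g₃ (-n)) := by
  have hneg : ((-n : ℤ) : ℝ) / L = -((n : ℝ) / L) := by push_cast; ring
  set k := (n : ℝ) / L
  have hI := lintegral_modulation_le (m₁ n).enorm (m₂ n).enorm (m₃ (-n)).enorm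
    (disp k) (disp k) (disp k) (disp (-k))
  have hD : bracket (disp k - disp k - disp k - disp (-k)) = 1 := by
    have : disp k - disp k - disp k - disp (-k) = 0 := by unfold disp; ring
    rw [this]
    simp [bracket]
  rw [hD, ENNReal.ofReal_one, one_mul] at hI
  have hI' : ∫⁻ x, (wt (disp k) x)⁻¹ * ‖T x‖ₑ ^ 2 ≤ ∫⁻ x, (wt (disp k) x)⁻¹ *
      conv3 (fun y => ‖g₁ n y‖ₑ) (fun y => ‖g₂ n y‖ₑ) (fun y => ‖g₃ (-n) y‖ₑ) x ^ 2 := by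
    refine lintegral_mono fun x => ?_
    gcongr
    exact hT x
  set b := bracket k ^ (2 * s) with hb
  have hb1 : bracket k ≤ b := by
    conv_lhs => rw [← Real.rpow_one (bracket k)]
    exact Real.rpow_le_rpow_of_exponent_le (one_le_bracket _) (by linarith)
  have hb0 : 0 ≤ b := (bracket_pos k).le.trans hb1
  -- With no gain from the resonance, `s ≥ 1/2` is what pays for the derivative.
  have hk : k ^ 2 * b ≤ b * b * b := by
    have h1 : |k| ≤ b := le_trans (by unfold bracket; linarith) hb1
    have h2 : k ^ 2 ≤ b * b := by
      rw [← sq_abs, sq]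
      exact mul_le_mul h1 h1 (abs_nonneg _) hb0
    exact mul_le_mul_of_nonneg_right h2 hb0
  calc _ ≤ ENNReal.ofReal (b * b * b) * (48 * kap ^ 2 *
        ((∫⁻ y, wt (disp k) y * ‖g₁ n y‖ₑ ^ 2) * (∫⁻ y, wt (disp k) y * ‖g₂ n y‖ₑ ^ 2) *
          ∫⁻ y, wt (disp (-k)) y * ‖g₃ (-n) y‖ₑ ^ 2)) :=
        mul_le_mul' (ENNReal.ofReal_le_ofReal hk) (hI'.trans hI)
    _ = _ := by
        rw [ENNReal.ofReal_mul (by positivity), ENNReal.ofReal_mul hb0]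
        simp only [energy, hneg, bracket_neg]
        rw [← hb]
        ring

/-- Square integrability in time of the sum of the nonresonant interactions at a fixed output
frequency. -/
theorem lintegral_tsum_nonresonant_sq_lt_top (hs : 1 / 2 ≤ s) (hL : 1 ≤ L)
    (m₁ : ∀ n, Measurable (g₁ n)) (m₂ : ∀ n, Measurable (g₂ n)) (m₃ : ∀ n, Measurable (g₃ n))
    (e₁ : ∑' n, energy L s g₁ n < ∞) (e₂ : ∑' n, energy L s g₂ n < ∞)
    (e₃ : ∑' n, energy L s g₃ n < ∞) {n : ℤ} {x : nonresonant n → ℝ → ℝ≥0∞}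
    (hx : ∀ q, AEMeasurable (x q) volume)
    (h : ∀ q, ∫⁻ t, x q t ^ 2 ≤ ∫⁻ τ, conv3 (fun y => ‖g₁ (q : ℤ × ℤ × ℤ).1 y‖ₑ)
      (fun y => ‖g₂ (q : ℤ × ℤ × ℤ).2.1 y‖ₑ) (fun y => ‖g₃ (q : ℤ × ℤ × ℤ).2.2 y‖ₑ) τ ^ 2) :
    ∫⁻ t, (∑' q, x q t) ^ 2 < ∞ := by
  -- The energies contain at least one full power of each bracket because `s ≥ 1/2`, so they absorb
  -- the inverse of this weight.
  set ω : nonresonant n → ℝ≥0∞ := fun q => (wt 0 ((q : ℤ × ℤ × ℤ).1 / L))⁻¹ *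
    (wt 0 ((q : ℤ × ℤ × ℤ).2.1 / L))⁻¹ * (wt 0 ((q : ℤ × ℤ × ℤ).2.2 / L))⁻¹ with hω
  have hi0 : ∀ y, (wt 0 y)⁻¹ ≠ 0 := fun y => ENNReal.inv_ne_zero.2 (wt_ne_top _ _)
  have hi1 : ∀ y, (wt 0 y)⁻¹ ≠ ∞ := fun y => ENNReal.inv_ne_top.2 (wt_ne_zero _ _)
  have key := lintegral_tsum_sq_le hx (W := fun _ => 1) measurable_const (ω := ω)
    (fun q => mul_ne_zero (mul_ne_zero (hi0 _) (hi0 _)) (hi0 _))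
    (fun q => ENNReal.mul_ne_top (ENNReal.mul_ne_top (hi1 _) (hi1 _)) (hi1 _))
  simp only [one_mul] at key
  refine key.trans_lt (ENNReal.mul_lt_top (tsum_inv_bracket_lt_top hL n) ?_)
  have hterm : ∀ q : nonresonant n, (ω q)⁻¹ * ∫⁻ t, x q t ^ 2 ≤ 3 * kap ^ 2 *
      (energy L s g₁ (q : ℤ × ℤ × ℤ).1 * energy L s g₂ (q : ℤ × ℤ × ℤ).2.1 *
        energy L s g₃ (q : ℤ × ℤ × ℤ).2.2) := by
    rintro q
    have hinv : (ω q)⁻¹ = wt 0 ((q : ℤ × ℤ × ℤ).1 / L) * wt 0 ((q : ℤ × ℤ × ℤ).2.1 / L) *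
        wt 0 ((q : ℤ × ℤ × ℤ).2.2 / L) := by
      simp only [hω]
      rw [ENNReal.mul_inv (Or.inr (hi1 _)) (Or.inr (hi0 _)),
        ENNReal.mul_inv (Or.inr (hi1 _)) (Or.inr (hi0 _)), inv_inv, inv_inv, inv_inv]
    have hc := lintegral_conv3_sq_le (m₁ (q : ℤ × ℤ × ℤ).1).enorm (m₂ (q : ℤ × ℤ × ℤ).2.1).enorm
      (m₃ (q : ℤ × ℤ × ℤ).2.2).enorm (disp ((q : ℤ × ℤ × ℤ).1 / L))
      (disp ((q : ℤ × ℤ × ℤ).2.1 / L)) (disp ((q : ℤ × ℤ × ℤ).2.2 / L))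
    rw [hinv]
    refine (mul_le_mul_right ((h q).trans hc) _).trans ?_
    refine le_trans (le_of_eq ?_) (mul_le_mul_right (mul_le_mul' (mul_le_mul'
      (lintegral_le_energy hs g₁ _) (lintegral_le_energy hs g₂ _))
      (lintegral_le_energy hs g₃ _)) _)
    ring
  refine (ENNReal.tsum_le_tsum hterm).trans_lt ?_
  rw [ENNReal.tsum_mul_left]
  refine ENNReal.mul_lt_top (ENNReal.mul_lt_top (by norm_num) (ENNReal.pow_lt_top kap_lt_top)) ?_
  refine lt_of_le_of_lt ?_ (ENNReal.mul_lt_top (ENNReal.mul_lt_top e₁ e₂) e₃)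
  exact (ENNReal.le_tsum (f := fun n => ∑' q : nonresonant n,
    energy L s g₁ (q : ℤ × ℤ × ℤ).1 * energy L s g₂ (q : ℤ × ℤ × ℤ).2.1 *
      energy L s g₃ (q : ℤ × ℤ × ℤ).2.2) n).trans (tsum_tsum_nonresonant_le _ _ _)

end

theorem enorm_sub_sq_le (a b : ℂ) : ‖a - b‖ₑ ^ 2 ≤ 2 * (‖a‖ₑ ^ 2 + ‖b‖ₑ ^ 2) :=
  (pow_le_pow_left' (enorm_sub_le (a := a) (b := b)) 2).trans (ENNReal_add_sq_le _ _)

/-- The space-time Fourier transform of `J[u,v,w]` and its dual energy. -/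
theorem exists_isTimeFourier_J {s δ : ℝ} (hs : 1 / 2 ≤ s) (hδ : 0 < δ) (hδ' : δ ≤ 1 / 2) :
    ∃ K : ℝ≥0∞, K ≠ ∞ ∧ ∀ (L : ℝ), 1 ≤ L → ∀ (u v w : ℝ → ℝ → ℂ) (g₁ g₂ g₃ : ℤ → ℝ → ℂ),
      (∀ n, IsTimeFourier (xCoeff L u n) (g₁ n)) → (∀ n, IsTimeFourier (xCoeff L v n) (g₂ n)) →
      (∀ n, IsTimeFourier (xCoeff L w n) (g₃ n)) →
      (∀ n, Measurable (g₁ n)) → (∀ n, Measurable (g₂ n)) → (∀ n, Measurable (g₃ n)) →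
      ∑' n, energy L s g₁ n < ∞ → ∑' n, energy L s g₂ n < ∞ → ∑' n, energy L s g₃ n < ∞ →
      (∀ᵐ t : ℝ, ∀ n : ℤ, Summable fun p : nonresonant n => tripleTerm L u v w t p) ∧
      ∃ G : ℤ → ℝ → ℂ, (∀ n, IsTimeFourier (J L u v w n) (G n)) ∧
        ∑' n, dualEnergy L s G n ≤ K * ENNReal.ofReal (L ^ (2 * δ - 2)) *
          ((∑' n, energy L s g₁ n) * (∑' n, energy L s g₂ n) * ∑' n, energy L s g₃ n) := by
  obtain ⟨C, hC, hω⟩ := tsum_freqWeight_le (p := 1 + δ) (by linarith)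
  refine ⟨2 * (48000 * kap ^ 2 * ENNReal.ofReal C + 48 * kap ^ 2), ?_, ?_⟩
  · have := kap_lt_top.ne
    finiteness
  intro L hL u v w g₁ g₂ g₃ h₁ h₂ h₃ m₁ m₂ m₃ e₁ e₂ e₃
  have hL0 : 0 < L := by linarith
  have hT : ∀ q : ℤ × ℤ × ℤ, ∃ T : ℝ → ℂ, Measurable T ∧
      IsTimeFourier (fun t => tripleTerm L u v w t q) T ∧
      (∀ x, ‖T x‖ₑ ≤ conv3 (fun y => ‖g₁ q.1 y‖ₑ) (fun y => ‖g₂ q.2.1 y‖ₑ)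
        (fun y => ‖g₃ q.2.2 y‖ₑ) x) ∧
      ∫⁻ t, ‖tripleTerm L u v w t q‖ₑ ^ 2 = ∫⁻ x, ‖T x‖ₑ ^ 2 := fun q =>
    exists_isTimeFourier_triple (h₁ _) (h₂ _) (h₃ _) (m₁ _) (m₂ _) (m₃ _)
      (lintegral_lt_top_of_energy e₁ _) (lintegral_lt_top_of_energy e₂ _)
      (lintegral_lt_top_of_energy e₃ _)
  choose T mT hT eT nT using hT
  have hT2 : ∀ q : ℤ × ℤ × ℤ, ∫⁻ x, ‖T q x‖ₑ ^ 2 ≤ ∫⁻ τ, conv3 (fun y => ‖g₁ q.1 y‖ₑ)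
      (fun y => ‖g₂ q.2.1 y‖ₑ) (fun y => ‖g₃ q.2.2 y‖ₑ) τ ^ 2 := fun q =>
    lintegral_mono fun x => pow_le_pow_left' (eT q x) 2
  have am : ∀ q : ℤ × ℤ × ℤ, AEStronglyMeasurable (fun t => tripleTerm L u v w t q) volume :=
    fun q => (hT q).locallyIntegrable_left.aestronglyMeasurable
  have sqf : ∀ n, ∫⁻ t, (∑' q : nonresonant n, ‖tripleTerm L u v w t q‖ₑ) ^ 2 < ∞ := fun n =>
    lintegral_tsum_nonresonant_sq_lt_top hs hL m₁ m₂ m₃ e₁ e₂ e₃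
      (x := fun (q : nonresonant n) t => ‖tripleTerm L u v w t q‖ₑ) (fun q => (am q).enorm)
      fun q => (nT q).trans_le (hT2 q)
  have sqT : ∀ n, ∫⁻ t, (∑' q : nonresonant n, ‖T q t‖ₑ) ^ 2 < ∞ := fun n =>
    lintegral_tsum_nonresonant_sq_lt_top hs hL m₁ m₂ m₃ e₁ e₂ e₃
      (x := fun (q : nonresonant n) t => ‖T q t‖ₑ) (fun q => (mT q).enorm.aemeasurable)
      fun q => hT2 q
  refine ⟨ae_all_iff.2 fun n => ae_summable_of_lintegral_tsum_sq_lt_top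
    (f := fun (q : nonresonant n) t => tripleTerm L u v w t q) (fun q => am q) (sqf n), ?_⟩
  set c : ℤ → ℂ := fun n => Complex.I * (((n : ℝ) / L : ℝ) : ℂ) * (1 / (L : ℂ) ^ 2) with hc
  refine ⟨fun n τ => c n / 3 * (∑' q : nonresonant n, T q τ) - c n * T (n, n, -n) τ,
    fun n => ?_, ?_⟩
  · have hsum : IsTimeFourier (fun t => ∑' q : nonresonant n, tripleTerm L u v w t q)
        fun τ => ∑' q : nonresonant n, T q τ :=
      isTimeFourier_tsum (f := fun (q : nonresonant n) t => tripleTerm L u v w t q)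
        (g := fun (q : nonresonant n) t => T q t) (fun q => hT q) (sqf n) (sqT n)
    have hJ : J L u v w n = fun t => c n / 3 * (∑' q : nonresonant n, tripleTerm L u v w t q) -
        c n * tripleTerm L u v w t (n, n, -n) := by
      ext t
      simp only [J, tripleTerm, hc]
      ring
    rw [hJ]
    exact (hsum.const_mul _).sub ((hT _).const_mul _)
  set A := (∑' n, energy L s g₁ n) * (∑' n, energy L s g₂ n) * ∑' n, energy L s g₃ n
  have hcn : ∀ n : ℤ, ‖c n‖ₑ ^ 2 = ENNReal.ofReal (L ^ (-4 : ℝ)) *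
      ENNReal.ofReal (((n : ℝ) / L) ^ 2) := fun n => by
    have h : ‖c n‖ = |(n : ℝ) / L| * (1 / L ^ 2) := by
      simp only [hc, norm_mul, Complex.norm_I, one_mul, Complex.norm_real, Real.norm_eq_abs,
        norm_div, norm_one, norm_pow, abs_div, abs_of_pos hL0]
    rw [← ofReal_norm, h, ← ENNReal.ofReal_pow (by positivity), ← ENNReal.ofReal_mul (by positivity)]
    congr 1
    rw [mul_pow, sq_abs, Real.rpow_neg hL0.le, mul_comm]
    congr 1
    rw [show (4 : ℝ) = ((4 : ℕ) : ℝ) by norm_num, Real.rpow_natCast]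
    field_simp
  have hsplit : ∀ n : ℤ, dualEnergy L s (fun n τ => c n / 3 * (∑' q : nonresonant n, T q τ) -
      c n * T (n, n, -n) τ) n ≤ 2 * ENNReal.ofReal (L ^ (-4 : ℝ)) *
      (ENNReal.ofReal (((n : ℝ) / L) ^ 2 * bracket ((n : ℝ) / L) ^ (2 * s)) *
        (∫⁻ τ, (wt (disp ((n : ℝ) / L)) τ)⁻¹ * (∑' q : nonresonant n, ‖T q τ‖ₑ) ^ 2) +
      ENNReal.ofReal (((n : ℝ) / L) ^ 2 * bracket ((n : ℝ) / L) ^ (2 * s)) *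
        ∫⁻ τ, (wt (disp ((n : ℝ) / L)) τ)⁻¹ * ‖T (n, n, -n) τ‖ₑ ^ 2) := fun n => by
    have hpt : ∀ τ, (wt (disp ((n : ℝ) / L)) τ)⁻¹ *
        ‖c n / 3 * (∑' q : nonresonant n, T q τ) - c n * T (n, n, -n) τ‖ₑ ^ 2 ≤
        2 * ‖c n‖ₑ ^ 2 * ((wt (disp ((n : ℝ) / L)) τ)⁻¹ *
          (∑' q : nonresonant n, ‖T q τ‖ₑ) ^ 2 +
          (wt (disp ((n : ℝ) / L)) τ)⁻¹ * ‖T (n, n, -n) τ‖ₑ ^ 2) := fun τ => by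
      have h3 : ‖c n / 3‖ₑ ≤ ‖c n‖ₑ := by
        rw [enorm_le_iff_norm_le, norm_div]
        have : ‖(3 : ℂ)‖ = 3 := by norm_num
        rw [this]
        linarith [norm_nonneg (c n)]
      calc _ ≤ (wt (disp ((n : ℝ) / L)) τ)⁻¹ * (2 * ((‖c n‖ₑ *
              ∑' q : nonresonant n, ‖T q τ‖ₑ) ^ 2 + (‖c n‖ₑ * ‖T (n, n, -n) τ‖ₑ) ^ 2)) := by
            refine mul_le_mul_right ((enorm_sub_sq_le _ _).trans ?_) _
            rw [enorm_mul, enorm_mul]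
            gcongr
            exact enorm_tsum_le_tsum_enorm
        _ = _ := by ring
    have mS : AEMeasurable (fun τ => (wt (disp ((n : ℝ) / L)) τ)⁻¹ *
        (∑' q : nonresonant n, ‖T q τ‖ₑ) ^ 2) volume :=
      (measurable_wt _).inv.aemeasurable.mul
        ((AEMeasurable.tsum fun q : nonresonant n => (mT q).enorm.aemeasurable).pow_const 2)
    have mD : AEMeasurable (fun τ => (wt (disp ((n : ℝ) / L)) τ)⁻¹ *
        ‖T (n, n, -n) τ‖ₑ ^ 2) volume :=
      (measurable_wt _).inv.aemeasurable.mul ((mT _).enorm.aemeasurable.pow_const 2)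
    have hle := lintegral_mono hpt (μ := volume)
    rw [lintegral_const_mul' _ _ (by finiteness), lintegral_add_left' mS, hcn] at hle
    refine (mul_le_mul_right hle _).trans (le_of_eq ?_)
    rw [ENNReal.ofReal_mul (sq_nonneg _)]
    ring
  have hnr : ∀ n : ℤ, ENNReal.ofReal (((n : ℝ) / L) ^ 2 * bracket ((n : ℝ) / L) ^ (2 * s)) *
        (∫⁻ τ, (wt (disp ((n : ℝ) / L)) τ)⁻¹ * (∑' q : nonresonant n, ‖T q τ‖ₑ) ^ 2) ≤
      48000 * kap ^ 2 * ENNReal.ofReal (C * L ^ (2 * (1 + δ))) *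
        ∑' q : nonresonant n, energy L s g₁ (q : ℤ × ℤ × ℤ).1 *
          energy L s g₂ (q : ℤ × ℤ × ℤ).2.1 * energy L s g₃ (q : ℤ × ℤ × ℤ).2.2 := fun n => by
    have key := lintegral_tsum_sq_le (x := fun (q : nonresonant n) τ => ‖T q τ‖ₑ)
      (fun q => (mT q).enorm.aemeasurable) (W := fun τ => (wt (disp ((n : ℝ) / L)) τ)⁻¹)
      (measurable_wt _).inv
      (ω := fun q => ENNReal.ofReal (freqWeight (1 + δ) ((q : ℤ × ℤ × ℤ).1 / L)
        ((q : ℤ × ℤ × ℤ).2.1 / L) ((q : ℤ × ℤ × ℤ).2.2 / L)))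
      (fun q => by simpa using freqWeight_pos _ _ _ _) (fun q => ENNReal.ofReal_ne_top)
    refine (mul_le_mul_right (key.trans (mul_le_mul_left (hω L hL n) _)) _).trans ?_
    rw [mul_left_comm, ← ENNReal.tsum_mul_left]
    refine (mul_le_mul_right (ENNReal.tsum_le_tsum fun q => nonresonant_energy_le hs hδ.le hδ' hL
      m₁ m₂ m₃ q (eT q)) _).trans (le_of_eq ?_)
    rw [ENNReal.tsum_mul_left]
    ring
  have hdiag : ∑' n, energy L s g₁ n * energy L s g₂ n * energy L s g₃ (-n) ≤ A := by
    calc _ ≤ ∑' n, energy L s g₁ n * ((∑' m, energy L s g₂ m) * ∑' m, energy L s g₃ m) := by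
          refine ENNReal.tsum_le_tsum fun n => ?_
          rw [mul_assoc]
          gcongr
          · exact ENNReal.le_tsum n
          · exact ENNReal.le_tsum (-n)
      _ = A := by rw [ENNReal.tsum_mul_right, ← mul_assoc]
  refine (ENNReal.tsum_le_tsum fun n => (hsplit n).trans (mul_le_mul_right (add_le_add (hnr n)
    (resonant_energy_le hs m₁ m₂ m₃ (eT (n, n, -n)))) _)).trans ?_
  rw [ENNReal.tsum_mul_left, ENNReal.tsum_add, ENNReal.tsum_mul_left, ENNReal.tsum_mul_left]
  -- The diagonal term involves no lattice sum, so its power of `L` is smaller and may be raised to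
  -- that of the nonresonant part.
  have hone : (1 : ℝ≥0∞) ≤ ENNReal.ofReal (L ^ (2 * (1 + δ))) := by
    rw [ENNReal.one_le_ofReal]
    exact Real.one_le_rpow hL (by linarith)
  have hLL : ENNReal.ofReal (L ^ (-4 : ℝ)) * ENNReal.ofReal (L ^ (2 * (1 + δ))) =
      ENNReal.ofReal (L ^ (2 * δ - 2)) := by
    rw [← ENNReal.ofReal_mul (by positivity), ← Real.rpow_add hL0]
    ring_nf
  calc 2 * ENNReal.ofReal (L ^ (-4 : ℝ)) *
        (48000 * kap ^ 2 * ENNReal.ofReal (C * L ^ (2 * (1 + δ))) *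
          (∑' (n : ℤ) (q : nonresonant n), energy L s g₁ (q : ℤ × ℤ × ℤ).1 *
            energy L s g₂ (q : ℤ × ℤ × ℤ).2.1 * energy L s g₃ (q : ℤ × ℤ × ℤ).2.2) +
        48 * kap ^ 2 * ∑' n, energy L s g₁ n * energy L s g₂ n * energy L s g₃ (-n))
      ≤ 2 * ENNReal.ofReal (L ^ (-4 : ℝ)) *
        (48000 * kap ^ 2 * (ENNReal.ofReal C * ENNReal.ofReal (L ^ (2 * (1 + δ)))) * A +
          48 * kap ^ 2 * (ENNReal.ofReal (L ^ (2 * (1 + δ))) * A)) := by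
        rw [ENNReal.ofReal_mul hC.le]
        gcongr
        · exact tsum_tsum_nonresonant_le _ _ _
        · exact hdiag.trans (le_mul_of_one_le_left' hone)
    _ = 2 * (48000 * kap ^ 2 * ENNReal.ofReal C + 48 * kap ^ 2) *
        (ENNReal.ofReal (L ^ (-4 : ℝ)) * ENNReal.ofReal (L ^ (2 * (1 + δ)))) * A := by ring
    _ = _ := by rw [hLL]

/-- Measurable space-time Fourier transforms almost attaining the Bourgain norm. -/
theorem MemBourgain.exists_transform {L s : ℝ} (hL : 1 ≤ L) {u : ℝ → ℝ → ℂ}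
    (h : MemBourgain L s (1 / 2) u) {e : ℝ≥0∞} (he : e ≠ 0) :
    ∃ g : ℤ → ℝ → ℂ, (∀ n, IsTimeFourier (xCoeff L u n) (g n)) ∧ (∀ n, Measurable (g n)) ∧
      ∑' n, energy L s g n < ∞ ∧
      (ENNReal.ofReal (1 / L) * ∑' n, energy L s g n) ^ (1 / 2 : ℝ) ≤
        bourgainNorm L s (1 / 2) (xCoeff L u) + e := by
  have hlt : bourgainNorm L s (1 / 2) (xCoeff L u) < bourgainNorm L s (1 / 2) (xCoeff L u) + e :=
    ENNReal.lt_add_right h.norm_lt_top.ne he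
  -- The minimum with `∞` keeps the chosen energy finite even when `e = ∞`.
  have hlt' : bourgainNorm L s (1 / 2) (xCoeff L u) <
      min (bourgainNorm L s (1 / 2) (xCoeff L u) + e) ∞ := lt_min hlt h.norm_lt_top
  obtain ⟨g, hg⟩ := iInf_lt_iff.1 hlt'
  obtain ⟨hF, hg⟩ := iInf_lt_iff.1 hg
  have hm : ∀ n, AEStronglyMeasurable (g n) volume := fun n =>
    (hF n).locallyIntegrable_right.aestronglyMeasurable
  set g' : ℤ → ℝ → ℂ := fun n => (hm n).mk (g n)
  have hgg : ∀ n, g n =ᵐ[volume] g' n := fun n => (hm n).ae_eq_mk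
  have hE : ∀ n, energy L s g' n = energy L s g n := fun n => by
    unfold energy
    congr 1
    exact lintegral_congr_ae ((hgg n).symm.mono fun x hx => by simp only [hx])
  rw [weightedNorm_half] at hg
  refine ⟨g', fun n => (hF n).congr_right (hgg n),
    fun n => (hm n).stronglyMeasurable_mk.measurable, ?_, ?_⟩
  · have h1 := hg.trans_le (min_le_right _ _)
    rw [ENNReal.rpow_lt_top_iff_of_pos (by norm_num)] at h1
    simp only [hE]
    refine ENNReal.lt_top_of_mul_ne_top_right h1.ne ?_
    simp only [ne_eq, ENNReal.ofReal_eq_zero, not_le]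
    positivity
  · simp only [hE]
    exact (hg.trans_le (min_le_left _ _)).le

end MKdV

end

/-! ### Conclusion: from transforms to norms -/

theorem proposition3p1 (s : ℝ) (hs : 1 / 2 ≤ s) (ε : ℝ) (hε : 0 < ε) :
    ∃ C : ℝ, 0 < C ∧ ∀ L : ℝ, 1 ≤ L → ∀ u v w : ℝ → ℝ → ℂ,
      MKdV.MemBourgain L s (1 / 2) u → MKdV.MemBourgain L s (1 / 2) v →
      MKdV.MemBourgain L s (1 / 2) w →
      (∀ᵐ t : ℝ, ∀ n : ℤ,
        Summable (fun p : MKdV.nonresonant n => MKdV.tripleTerm L u v w t p)) ∧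
      MKdV.bourgainNorm L s (-(1 / 2)) (MKdV.J L u v w) ≤
        ENNReal.ofReal (C * L ^ ε) *
          MKdV.bourgainNorm L s (1 / 2) (MKdV.xCoeff L u) *
          MKdV.bourgainNorm L s (1 / 2) (MKdV.xCoeff L v) *
          MKdV.bourgainNorm L s (1 / 2) (MKdV.xCoeff L w) := by
  -- The multiplier estimate needs `δ ≤ 1/2`; since `L ≥ 1`, a smaller exponent is harmless.
  set δ := min ε (1 / 2)
  have hδ : 0 < δ := lt_min hε (by norm_num)
  have hδε : δ ≤ ε := min_le_left _ _
  obtain ⟨K, hK, hmain⟩ := MKdV.exists_isTimeFourier_J hs hδ (min_le_right _ _)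
  refine ⟨Real.sqrt K.toReal + 1, by positivity, fun L hL u v w hu hv hw => ?_⟩
  have hL0 : 0 < L := by linarith
  set C := Real.sqrt K.toReal + 1
  have hC : 0 ≤ C := by positivity
  have hKC : K ≤ ENNReal.ofReal C ^ 2 := by
    rw [← ENNReal.ofReal_pow hC, ← ENNReal.ofReal_toReal hK]
    refine ENNReal.ofReal_le_ofReal ?_
    have h1 := Real.sq_sqrt (ENNReal.toReal_nonneg (a := K))
    have h2 := Real.sqrt_nonneg K.toReal
    simp only [C]
    nlinarith
  set Nu := MKdV.bourgainNorm L s (1 / 2) (MKdV.xCoeff L u)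
  set Nv := MKdV.bourgainNorm L s (1 / 2) (MKdV.xCoeff L v)
  set Nw := MKdV.bourgainNorm L s (1 / 2) (MKdV.xCoeff L w)
  -- Working with transforms that nearly attain the infima avoids any appeal to uniqueness of the
  -- transform; `e → 0` at the end.
  have happrox : ∀ e : ℝ≥0∞, e ≠ 0 →
      (∀ᵐ t : ℝ, ∀ n : ℤ,
        Summable (fun p : MKdV.nonresonant n => MKdV.tripleTerm L u v w t p)) ∧
      MKdV.bourgainNorm L s (-(1 / 2)) (MKdV.J L u v w) ≤
        ENNReal.ofReal (C * L ^ ε) * (Nu + e) * (Nv + e) * (Nw + e) := by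
    intro e he
    obtain ⟨g₁, h₁, m₁, e₁, n₁⟩ := hu.exists_transform hL he
    obtain ⟨g₂, h₂, m₂, e₂, n₂⟩ := hv.exists_transform hL he
    obtain ⟨g₃, h₃, m₃, e₃, n₃⟩ := hw.exists_transform hL he
    obtain ⟨hsum, G, hG, hGle⟩ := hmain L hL u v w g₁ g₂ g₃ h₁ h₂ h₃ m₁ m₂ m₃ e₁ e₂ e₃
    refine ⟨hsum, (iInf₂_le G hG).trans ?_⟩
    rw [MKdV.weightedNorm_neg_half]
    set A₁ := ∑' n, MKdV.energy L s g₁ n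
    set A₂ := ∑' n, MKdV.energy L s g₂ n
    set A₃ := ∑' n, MKdV.energy L s g₃ n
    set ℓ := ENNReal.ofReal (1 / L)
    -- The factor `ℓ³` supplies one normalization `1/L` to each of the three input norms.
    have hscale : ℓ * ENNReal.ofReal (L ^ (2 * δ - 2)) = ENNReal.ofReal (L ^ δ) ^ 2 * ℓ ^ 3 := by
      simp only [ℓ]
      rw [← ENNReal.ofReal_pow (by positivity), ← ENNReal.ofReal_pow (by positivity),
        ← ENNReal.ofReal_mul (by positivity), ← ENNReal.ofReal_mul (by positivity)]
      congr 1
      have e1 : L ^ (2 * δ - 2) = (L ^ δ) ^ 2 / L ^ 2 := by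
        rw [Real.rpow_sub hL0, mul_comm 2 δ, Real.rpow_mul hL0.le]
        norm_num
      rw [e1]
      field_simp
    have hhalf : ∀ z : ℝ≥0∞, (z ^ 2) ^ (1 / 2 : ℝ) = z := fun z => by
      rw [← ENNReal.rpow_natCast, ← ENNReal.rpow_mul]
      norm_num
    have hle : ℓ * ∑' n, MKdV.dualEnergy L s G n ≤
        (ENNReal.ofReal C * ENNReal.ofReal (L ^ δ)) ^ 2 * (ℓ * A₁) * (ℓ * A₂) * (ℓ * A₃) := by
      calc ℓ * ∑' n, MKdV.dualEnergy L s G n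
          ≤ ℓ * (ENNReal.ofReal C ^ 2 * ENNReal.ofReal (L ^ (2 * δ - 2)) * (A₁ * A₂ * A₃)) :=
            mul_le_mul_right (hGle.trans (by gcongr)) _
        _ = ENNReal.ofReal C ^ 2 * (ℓ * ENNReal.ofReal (L ^ (2 * δ - 2))) * (A₁ * A₂ * A₃) := by
            ring
        _ = _ := by rw [hscale]; ring
    have hroot := ENNReal.rpow_le_rpow hle (by norm_num : (0 : ℝ) ≤ 1 / 2)
    refine hroot.trans ?_
    rw [ENNReal.mul_rpow_of_nonneg _ _ (by norm_num), ENNReal.mul_rpow_of_nonneg _ _ (by norm_num),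
      ENNReal.mul_rpow_of_nonneg _ _ (by norm_num), hhalf, ← ENNReal.ofReal_mul hC]
    gcongr
  refine ⟨(happrox 1 one_ne_zero).1, ?_⟩
  have hlim : Filter.Tendsto (fun e : ℝ≥0∞ =>
      ENNReal.ofReal (C * L ^ ε) * (Nu + e) * (Nv + e) * (Nw + e)) (nhdsWithin 0 (Set.Ioi 0))
      (nhds (ENNReal.ofReal (C * L ^ ε) * (Nu + 0) * (Nv + 0) * (Nw + 0))) := by
    have hadd : ∀ N : ℝ≥0∞, Filter.Tendsto (fun e : ℝ≥0∞ => N + e) (nhdsWithin 0 (Set.Ioi 0))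
        (nhds (N + 0)) := fun N =>
      (tendsto_const_nhds.add Filter.tendsto_id).mono_left nhdsWithin_le_nhds
    have hu' : Nu + 0 ≠ ∞ := by rw [add_zero]; exact hu.norm_lt_top.ne
    have hv' : Nv + 0 ≠ ∞ := by rw [add_zero]; exact hv.norm_lt_top.ne
    have hw' : Nw + 0 ≠ ∞ := by rw [add_zero]; exact hw.norm_lt_top.ne
    have hc' : ENNReal.ofReal (C * L ^ ε) ≠ ∞ := ENNReal.ofReal_ne_top
    refine ENNReal.Tendsto.mul (ENNReal.Tendsto.mul (ENNReal.Tendsto.const_mul (hadd Nu)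
      (Or.inr hc')) (Or.inr hv') (hadd Nv) (Or.inr (ENNReal.mul_ne_top hc' hu')))
      (Or.inr hw') (hadd Nw) (Or.inr (ENNReal.mul_ne_top (ENNReal.mul_ne_top hc' hu') hv'))
  simp only [add_zero] at hlim
  refine ge_of_tendsto hlim ?_
  filter_upwards [self_mem_nhdsWithin] with e he
  exact (happrox e (ne_of_gt he)).2
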